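/- **Setting.** Let $J\colon\mathbb Z^d\to\mathbb R$ satisfy: $J(x)\ge 0$ for $x\ne 0$ and $J(0)=-\sum_{x\neq 0}J(x)$ with a convergent sum; $\{x: J(x)>0\}$ generates $\mathbb Z^d$; $J$ is invariant under the automorphisms of the nearest-neighbour graph $\mathbb Z^d$ that fix $0$; $J$ has finite range. Let $\Omega_1$ be the space of càdlàg paths $[0,\infty)\to\mathbb Z^d$ with the $\sigma$-algebra generated by the coordinates, and for $a\in\mathbb Z^d$ let $P_a$ (expectation $E_a$) be the law on $\Omega_1$ of the continuous-time random walk started at $a$ with generator $\Delta_{x,y}=J(y-x)$. Let $\Lambda\subset\mathbb Z^d$ be finite, and let $X$ be the walk killed (sent to a cemetery state $\ast\notin\mathbb Z^d$) at its first exit time from $\Lambda$. For Borel $I\subset[0,\infty)$ let $\tau_I=(\tau_{I,x})_{x\in\Lambda}$ with $\tau_{I,x}=\int_I \mathbf 1_{\{X_\ell=x\}}\,d\ell$. Let $Z\colon[0,\infty)^\Lambda\to(0,\infty)$, $\mathbf t\mapsto Z_{\mathbf t}$. For $\mathbf t\in[0,\infty)^\Lambda$ and $a,b\in\Lambda$ put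 $$G_{\mathbf t}(a,b)=\int_0^\infty d\ell\; E_a\Big[\frac{Z_{\mathbf t+\tau_{[0,\ell]}}}{Z_{\mathbf t}}\mathbf 1_{\{X_\ell=b\}}\Big]\in[0,\infty],\qquad \mathcal Y_{s,t}=\frac{Z_{\tau_{[s,t]}}}{Z_{\mathbf 0}}\quad(0\le s\le t),$$ and, for $0\le s<t$, $r_{s,t}=-\partial_1\partial_2\log\mathcal Y_{s,t}$ (one-sided derivative in the first variable at $s=0$; defined for a.e. $(s,t)$), and for $x,y\in\Lambda$ $$r_{s,t}(x,y)=\partial_{t_x}\partial_{t_y}\log Z_{\mathbf t}\big|_{\mathbf t=\tau_{[s,t]}}.$$ For $m\ge1$ let $\mathcal L_m(0)\subset\mathbb R^{2m-1}$ be the set of laces $L$ started at $0$, i.e. of $(s_1,s_1',s_2,\dots,s_{m-1}',s_m)$ with $$0=s_0'<s_1<s_1'<s_2<s_2'<\dots<s_{m-1}'<s_m<\infty ,$$ with the conventions $s_0=s_0'$ and $s_m'=s_m$, and let $dL$ be Lebesgue measure on it. Define $$w(L)=\prod_{i=0}^{m-1}r_{s_i,s_{i+1}'}\;\cdot\;\mathcal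 Y_{s_0',s_1'}\prod_{i=0}^{m-2}\frac{\mathcal Y_{s_i',s_{i+2}'}}{\mathcal Y_{s_i',s_{i+1}'}},\qquad \Pi_m(x,y)=\int_{\mathcal L_m(0)}dL\;E_x\big[w(L)\mathbf 1_{\{X_{s_m'}=y\}}\big].$$ **Proposition 7.3.** Assume: - (Z1) $Z$ is strictly positive and continuous on $[0,\infty)^\Lambda$; - (Z2) $Z$ is $C^2$ on $[0,\infty)^\Lambda$, with derivatives extending continuously to the boundary; - (G0) $G_{\mathbf 0}(a,b)<\infty$ for all $a,b\in\Lambda$; - (G1) $G_{\mathbf t}(a,b)\le G_{\mathbf 0}(a,b)$ for all $\mathbf t\in[0,\infty)^\Lambda$ and $a,b\in\Lambda$; - (R0) $\bar r\colon\Lambda\times\Lambda\to\mathbb R$ is such that, $P_a$-almost surely for every $a\in\Lambda$, $|r_{u,v}(x,y)|\le\bar r(x,y)$ for all $x,y\in\Lambda$ and $0\le u<v<\infty$. Then for all $m\ge1$ and $x,y\in\Lambda$ the integral defining $\Pi_m(x,y)$ converges absolutely (jointly in the lace and the path) and $$|\Pi_m(x,y)|\le\sum G_{\mathbf 0}(x,x_1)\,\bar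 r(x,x_1')\prod_{j=1}^{m-1}G_{\mathbf 0}(x_j,x_j')\,G_{\mathbf 0}(x_j',x_{j+1})\,\bar r(x_j,x_{j+1}'),$$ where the sum is over all sequences $((x_i,x_i'))_{i=0,\dots,m}$ in $\Lambda\times\Lambda$ with $x_0=x_0'=x$ and $x_m=x_m'=y$. -/

import Mathlib

open scoped NNReal ENNReal
open MeasureTheory

namespace LaceBound

/-! ### The jump function and the random walk on the integer lattice -/

/-- The vertex set of the integer lattice of dimension `d`. -/
abbrev Zd (d : ℕ) : Type := Fin d → ℤ

/-- Nearest neighbours: the edges of the integer lattice. -/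
def LatAdj {d : ℕ} (x y : Zd d) : Prop := ∑ i, |x i - y i| = 1

/-- Automorphisms of the lattice fixing the origin. -/
def IsLatAut₀ {d : ℕ} (T : Equiv.Perm (Zd d)) : Prop :=
  (∀ x y, LatAdj x y → LatAdj (T x) (T y)) ∧ T 0 = 0

/-- The standing assumptions on the jump function `J`. -/
structure IsJumpFunction {d : ℕ} (J : Zd d → ℝ) : Prop where
  nonneg : ∀ x, x ≠ 0 → 0 ≤ J x
  /-- `J 0 = - ∑_{x ≠ 0} J x`, where the sum converges. -/
  diag : HasSum (({0}ᶜ : Set (Zd d)).indicator J) (-J 0)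
  generating : AddSubgroup.closure {x | 0 < J x} = ⊤
  symm : ∀ T : Equiv.Perm (Zd d), IsLatAut₀ T → ∀ x, J (T x) = J x
  finiteRange : ∃ R : ℝ, 0 < R ∧ ∀ x : Zd d, R ≤ √(∑ i, (x i : ℝ) ^ 2) → J x = 0

/-- The off-diagonal part `J₊` of `J`. -/
noncomputable def Jplus {d : ℕ} (J : Zd d → ℝ) : Zd d → ℝ :=
  ({0}ᶜ : Set (Zd d)).indicator J

/-- The `n`-fold discrete convolution of `f` with itself. -/
noncomputable def convPow {d : ℕ} (f : Zd d → ℝ) : ℕ → Zd d → ℝ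
  | 0 => ({0} : Set (Zd d)).indicator 1
  | n + 1 => fun x => ∑' y, f y * convPow f n (x - y)

/-- Transition probability of the continuous-time walk with jump rates `J₊`, displacement `x`
in time `t`. The holding times are exponential with rate `q = -J 0` and the jumps have law
`J₊ / q`, so the number of jumps is Poisson of mean `q t` and
`p_t(x) = ∑ₙ exp(-q t) (q t)^n / n! · (J₊ / q)^{*n}(x)`, in which the powers of `q` cancel. -/
noncomputable def transProb {d : ℕ} (J : Zd d → ℝ) (t : ℝ) (x : Zd d) : ℝ :=
  ∑' n : ℕ, Real.exp (J 0 * t) * (t ^ n / (n.factorial : ℝ)) * convPow (Jplus J) n x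

/-- Right continuous with left limits. (The lattice carries the discrete topology.) -/
def IsCadlag {d : ℕ} (ω : ℝ≥0 → Zd d) : Prop :=
  (∀ t, ContinuousWithinAt ω (Set.Ici t) t) ∧
    ∀ t, ∃ l, Filter.Tendsto ω (nhdsWithin t (Set.Iio t)) (nhds l)

/-- The path space. Its (inherited) sigma-algebra is generated by the coordinate maps. -/
abbrev PathSpace (d : ℕ) : Type := {ω : ℝ≥0 → Zd d // IsCadlag ω}

/-- `P a` is, for every `a`, the law on path space of the continuous-time random walk with
generator `Δ_{x,y} = J (y - x)` started at `a`. The law is specified by its finite-dimensional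
distributions. -/
structure IsWalkLaw {d : ℕ} (J : Zd d → ℝ) (P : Zd d → Measure (PathSpace d)) : Prop where
  prob : ∀ a, IsProbabilityMeasure (P a)
  fdd : ∀ (a : Zd d) (n : ℕ) (t : ℕ → ℝ≥0) (x : ℕ → Zd d), t 0 = 0 → Monotone t →
    P a {ω | ∀ i ≤ n, ω.1 (t i) = x i} =
      ENNReal.ofReal (({a} : Set (Zd d)).indicator 1 (x 0) *
        ∏ i ∈ Finset.range n, transProb J ((t (i + 1) : ℝ) - t i) (x (i + 1) - x i))

/-! ### The killed walk and its local time -/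

section Walk

variable {d : ℕ}

/-- First exit time from `Λ`. -/
noncomputable def exitTime (Λ : Finset (Zd d)) (ω : PathSpace d) : ℝ≥0∞ :=
  ⨅ (t : ℝ≥0) (_ : ω.1 t ∉ Λ), (t : ℝ≥0∞)

/-- The walk killed on exiting `Λ`, at a time `t ≥ 0`; `none` is the cemetery state. -/
noncomputable def killed (Λ : Finset (Zd d)) (ω : PathSpace d) (t : ℝ) : Option (Zd d) :=
  if ENNReal.ofReal t < exitTime Λ ω then some (ω.1 t.toNNReal) else none

/-- The vector of local times of the killed walk during the time set `I ⊆ [0,∞)`. -/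
noncomputable def localTime (Λ : Finset (Zd d)) (ω : PathSpace d) (I : Set ℝ) : Λ → ℝ :=
  fun x => ∫ ℓ in I, ({s | killed Λ ω s = some x.1} : Set ℝ).indicator 1 ℓ

/-- The orthant `[0,∞)^Λ`. -/
def orthant (Λ : Finset (Zd d)) : Set (Λ → ℝ) := {t | ∀ x, 0 ≤ t x}

/-- The Green's function `G_t(a,b)`, with values in `[0,∞]`. Only the values of `Z` on
the orthant enter, for `t` in the orthant. -/
noncomputable def greenE (Λ : Finset (Zd d)) (Z : (Λ → ℝ) → ℝ)
    (P : Zd d → Measure (PathSpace d)) (t : Λ → ℝ) (a b : Λ) : ℝ≥0∞ :=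
  ∫⁻ ℓ in Set.Ici (0 : ℝ), ∫⁻ ω,
    ({ω' | killed Λ ω' ℓ = some b.1} : Set (PathSpace d)).indicator
      (fun ω' => ENNReal.ofReal (Z (t + localTime Λ ω' (Set.Icc 0 ℓ)) / Z t)) ω ∂(P a)

/-- The real number `G_0(a,b)` (under the assumption that it is finite). -/
noncomputable def green₀ (Λ : Finset (Zd d)) (Z : (Λ → ℝ) → ℝ)
    (P : Zd d → Measure (PathSpace d)) (a b : Λ) : ℝ :=
  (greenE Λ Z P 0 a b).toReal

/-! ### Vertex functions -/

/-- The random function `Y_{s,t} = Z(τ_{[s,t]}) / Z(0)`, for `0 ≤ s ≤ t`. -/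
noncomputable def Yfun (Λ : Finset (Zd d)) (Z : (Λ → ℝ) → ℝ) (ω : PathSpace d) (s t : ℝ) : ℝ :=
  Z (localTime Λ ω (Set.Icc s t)) / Z 0

/-- The vertex function `r_{s,t} = - ∂₁ ∂₂ log Y_{s,t}` for `0 ≤ s < t`. Derivatives are taken
within the domain `0 ≤ s ≤ t` of `Y`; they are one-sided only at `s = 0`. -/
noncomputable def vertex (Λ : Finset (Zd d)) (Z : (Λ → ℝ) → ℝ) (ω : PathSpace d)
    (s t : ℝ) : ℝ :=
  -derivWithin
    (fun s' => derivWithin (fun t' => Real.log (Yfun Λ Z ω s' t')) (Set.Ici s') t)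
    (Set.Icc 0 t) s

/-- The partial derivative `∂_{t_x} f` on the orthant (one-sided on its boundary). -/
noncomputable def partialDeriv (Λ : Finset (Zd d)) (x : Λ) (f : (Λ → ℝ) → ℝ) (t : Λ → ℝ) : ℝ :=
  lineDerivWithin ℝ f (orthant Λ) t (Pi.single x 1)

/-- `r_{u,v}(x,y) = ∂_{t_x} ∂_{t_y} log Z_t` at `t = τ_{[u,v]}`. -/
noncomputable def vertexAt (Λ : Finset (Zd d)) (Z : (Λ → ℝ) → ℝ) (ω : PathSpace d)
    (u v : ℝ) (x y : Λ) : ℝ :=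
  partialDeriv Λ x (partialDeriv Λ y (fun t => Real.log (Z t))) (localTime Λ ω (Set.Icc u v))

/-! ### Laces -/

/-- A lace with `m ≥ 1` intervals started at time `0` is a sequence of times
`0 = s₀' < s₁ < s₁' < s₂ < ⋯ < s'_{m-1} < s_m`; it is given by the vector of its `2 m - 1`
positive entries. -/
def laces₀ (m : ℕ) : Set (Fin (2 * m - 1) → ℝ) := {r | (∀ k, 0 < r k) ∧ StrictMono r}

/-- The `k`-th time, `0 ≤ k ≤ 2 m - 1`, in the ordered list of times of the lace. -/
noncomputable def laceTime (m : ℕ) (r : Fin (2 * m - 1) → ℝ) (k : ℕ) : ℝ :=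
  if h : 1 ≤ k ∧ k ≤ 2 * m - 1 then r ⟨k - 1, by omega⟩ else 0

/-- The times `s_i`, `0 ≤ i ≤ m`, where `s₀ = s₀' = 0`. -/
noncomputable def laceS (m : ℕ) (r : Fin (2 * m - 1) → ℝ) (i : ℕ) : ℝ :=
  if i = 0 then 0 else laceTime m r (2 * i - 1)

/-- The times `s_i'`, `0 ≤ i ≤ m`, where `s_m' = s_m`. -/
noncomputable def laceS' (m : ℕ) (r : Fin (2 * m - 1) → ℝ) (i : ℕ) : ℝ :=
  if i = m then laceS m r m else laceTime m r (2 * i)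

/-- The product `r(L) = ∏_{i<m} r_{s_i, s'_{i+1}}` of vertex functions. -/
noncomputable def laceVertex (Λ : Finset (Zd d)) (Z : (Λ → ℝ) → ℝ) (m : ℕ)
    (r : Fin (2 * m - 1) → ℝ) (ω : PathSpace d) : ℝ :=
  ∏ i ∈ Finset.range m, vertex Λ Z ω (laceS m r i) (laceS' m r (i + 1))

/-- `P(L) = Y_{s₀',s₁'} ∏_{i=0}^{m-2} Y_{s_i',s_{i+2}'} / Y_{s_i',s_{i+1}'}`. -/
noncomputable def laceP (Λ : Finset (Zd d)) (Z : (Λ → ℝ) → ℝ) (m : ℕ)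
    (r : Fin (2 * m - 1) → ℝ) (ω : PathSpace d) : ℝ :=
  Yfun Λ Z ω (laceS' m r 0) (laceS' m r 1) *
    ∏ i ∈ Finset.range (m - 1),
      Yfun Λ Z ω (laceS' m r i) (laceS' m r (i + 2)) /
        Yfun Λ Z ω (laceS' m r i) (laceS' m r (i + 1))

/-- The integrand `w(L) 1{X_{s_m'} = y}`, where `w(L) = r(L) P(L)` is the weight of the lace. -/
noncomputable def laceIntegrand (Λ : Finset (Zd d)) (Z : (Λ → ℝ) → ℝ) (m : ℕ) (y : Λ)
    (r : Fin (2 * m - 1) → ℝ) (ω : PathSpace d) : ℝ :=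
  ({ω' | killed Λ ω' (laceS' m r m) = some y.1} : Set (PathSpace d)).indicator
    (fun ω' => laceVertex Λ Z m r ω' * laceP Λ Z m r ω') ω

/-- The `m`-th lace expansion term, for `m ≥ 1`:
`Π_m(x,y) = ∫_{L_m(0)} dL E_x[w(L) 1{X_{s_m'} = y}]`. -/
noncomputable def lacePi (Λ : Finset (Zd d)) (Z : (Λ → ℝ) → ℝ)
    (P : Zd d → Measure (PathSpace d)) (m : ℕ) (x y : Λ) : ℝ :=
  ∫ r in laces₀ m, ∫ ω, laceIntegrand Λ Z m y r ω ∂(P x)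

/-! ### The diagrams -/

open scoped Classical in
/-- Sequences `((x_i, x_i'))_{i=0,…,m}` in `Λ` with `x_0 = x_0' = x` and `x_m = x_m' = y`. -/
noncomputable def diagramVertices (Λ : Finset (Zd d)) (m : ℕ) (x y : Λ) :
    Finset (Fin (m + 1) → Λ × Λ) :=
  Finset.univ.filter (fun v => v 0 = (x, x) ∧ v (Fin.last m) = (y, y))

end Walk

end LaceBound

open LaceBound

/-!
The weight of a lace is a product of vertex functions and of a factor `P(L)`. Away from its jumps,
the derivative of the local time vector in either end of a time interval is, up to the sign, the
basis vector of the position of the walk. Hence `r_{s,t} = r_{s,t}(X_s, X_t)` as long as `s` and `t`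
are not jump times (`vertex_eq_vertexAt`), and `|r_{s,t}|` is at most `rbar (X_s) (X_t)`. For each
path almost every time is not a jump time (`ae_noJump`), because a càdlàg path in a discrete space
is locally constant on either side of each time. So for almost every lace and path all vertex
functions are bounded by constants that depend only on the positions of the walk at the `2 m - 1`
times of the lace.

The factor `P(L)` telescopes (`laceP_eq_prod`) into one ratio `Z(τ_{[b,t']}) / Z(τ_{[b,t]})` for
each step from a time `t` of the lace to the next time `t'`, where `b ≤ t` is an earlier time of the
lace. Fix the positions of the walk at all times of the lace, and integrate over the last time. With
`𝐭 = τ_{[b,t]}` the last ratio is `Z(𝐭 + τ_{[t,t']}) / Z(𝐭)`, so by the Markov property at time `t`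
the integral over the last step is `G_𝐭`, which is at most `G_0`. Iteration bounds the integral of
`P(L)` by a product of `2 m - 1` factors `G_0` (`lintegral_walkWeight_le`), for any choice of the
earlier times `b`. Summation over the positions gives the diagrams.

The law of the walk is given only by its finite-dimensional distributions. Their product form gives
the independence of the stopped and the shifted path on cylinders, and a π-system argument extends
it to the path space (`IsWalkLaw.markov`).
-/

namespace LaceBound
open Set Filter Topology

variable {d : ℕ}

/-! ### Càdlàg lattice paths and the killed walk -/

lemma eventually_right_eq (ω : PathSpace d) (t : ℝ≥0) : ∀ᶠ s in 𝓝[≥] t, ω.1 s = ω.1 t := by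
  have h := ω.2.1 t
  rw [ContinuousWithinAt, nhds_discrete, tendsto_pure] at h
  exact h

lemma exists_eventually_left_eq (ω : PathSpace d) (t : ℝ≥0) :
    ∃ l, ∀ᶠ s in 𝓝[<] t, ω.1 s = l := by
  obtain ⟨l, h⟩ := ω.2.2 t
  rw [nhds_discrete, tendsto_pure] at h
  exact ⟨l, h⟩

lemma exists_right_eq (ω : PathSpace d) (t : ℝ≥0) :
    ∃ u, t < u ∧ ∀ s, t ≤ s → s < u → ω.1 s = ω.1 t := by
  obtain ⟨u, hu, h⟩ := (mem_nhdsGE_iff_exists_Ico_subset' (show t < t + 1 by simp)).1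
    (eventually_right_eq ω t)
  exact ⟨u, hu, fun s h1 h2 => h ⟨h1, h2⟩⟩

lemma lt_exitTime_iff (Λ : Finset (Zd d)) (ω : PathSpace d) (t : ℝ≥0) :
    (t : ℝ≥0∞) < exitTime Λ ω ↔ ∀ s ≤ t, ω.1 s ∈ Λ := by
  constructor
  · intro h s hs
    by_contra hc
    have : exitTime Λ ω ≤ s := iInf₂_le s hc
    exact absurd (h.trans_le this) (not_lt.2 (by exact_mod_cast hs))
  · intro h
    -- the path stays at `ω t ∈ Λ` for a while after `t`, so that the inequality is strict
    obtain ⟨u, hu, hc⟩ := exists_right_eq ω t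
    refine lt_of_lt_of_le (by exact_mod_cast hu) (le_iInf₂ fun s hs => ?_ : (u : ℝ≥0∞) ≤ _)
    by_contra hlt
    have hlt : s < u := by exact_mod_cast not_le.1 hlt
    rcases le_total s t with h1 | h1
    · exact hs (h s h1)
    · exact hs (hc s h1 hlt ▸ h t le_rfl)

lemma killed_eq_some_iff {Λ : Finset (Zd d)} {ω : PathSpace d} {t : ℝ} {x : Zd d} :
    killed Λ ω t = some x ↔ (∀ s ≤ t.toNNReal, ω.1 s ∈ Λ) ∧ ω.1 t.toNNReal = x := by
  unfold killed
  rw [← lt_exitTime_iff]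
  by_cases h : ENNReal.ofReal t < exitTime Λ ω
  · have h' : (t.toNNReal : ℝ≥0∞) < exitTime Λ ω := h
    simp [h, h']
  · have h' : ¬ (t.toNNReal : ℝ≥0∞) < exitTime Λ ω := h
    simp [h, h']

/-- A walk that is alive at time `t` has been alive, at a point of `Λ`, at all earlier times. -/
lemma exists_killed_eq_some_of_le {Λ : Finset (Zd d)} {ω : PathSpace d} {s t : ℝ} {y : Zd d}
    (h : killed Λ ω t = some y) (hst : s ≤ t) : ∃ x : Λ, killed Λ ω s = some x.1 := by
  rw [killed_eq_some_iff] at h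
  have hst' := Real.toNNReal_le_toNNReal hst
  exact ⟨⟨_, h.1 _ hst'⟩, killed_eq_some_iff.2 ⟨fun r hr => h.1 r (hr.trans hst'), rfl⟩⟩

lemma measurable_coord (t : ℝ≥0) : Measurable (fun ω : PathSpace d => ω.1 t) :=
  (measurable_pi_apply t).comp measurable_subtype_coe

/-- Joint measurability of `(t, ω) ↦ ω t`, which holds as `ω t` is the limit of the values of `ω`
at the multiples of `1 / n` just after `t`. -/
lemma measurable_eval : Measurable (fun p : ℝ≥0 × PathSpace d => p.2.1 p.1) := by
  let f : ℕ → ℝ≥0 × PathSpace d → Zd d := fun n p =>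
    p.2.1 ((⌊((n : ℝ≥0) + 1) * p.1⌋₊ + 1) / ((n : ℝ≥0) + 1))
  have hf : ∀ n, Measurable (f n) := by
    intro n
    have h1 : Measurable (fun q : ℕ × PathSpace d =>
        q.2.1 (((q.1 : ℝ≥0) + 1) / ((n : ℝ≥0) + 1))) :=
      measurable_from_prod_countable_right fun k =>
        measurable_coord (((k : ℝ≥0) + 1) / ((n : ℝ≥0) + 1))
    exact h1.comp (((measurable_const.mul measurable_fst).nat_floor).prodMk measurable_snd)
  refine measurable_of_tendsto_metrizable hf ?_
  rw [tendsto_pi_nhds]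
  rintro ⟨t, ω⟩
  rw [nhds_discrete, tendsto_pure]
  obtain ⟨u, hu, hc⟩ := exists_right_eq ω t
  have hε : (0 : ℝ) < (u : ℝ) - t := sub_pos.2 (by exact_mod_cast hu)
  obtain ⟨N, hN⟩ := exists_nat_one_div_lt hε
  filter_upwards [eventually_ge_atTop N] with n hn
  apply hc
  · rw [le_div_iff₀ (by positivity), mul_comm]
    exact (Nat.lt_floor_add_one _).le
  · have h1 : (1 : ℝ) / (n + 1) ≤ 1 / (N + 1) := by
      gcongr
    have h2 : ((⌊((n : ℝ≥0) + 1) * t⌋₊ : ℝ≥0) : ℝ) ≤ ((n : ℝ) + 1) * t := by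
      exact_mod_cast Nat.floor_le (zero_le (a := ((n : ℝ≥0) + 1) * t))
    rw [← NNReal.coe_lt_coe]
    push_cast at h2 ⊢
    have h3 : (0 : ℝ) < n + 1 := by positivity
    rw [div_lt_iff₀ h3]
    have h4 : (1 : ℝ) / (n + 1) < u - t := h1.trans_lt hN
    rw [div_lt_iff₀ h3] at h4
    linarith

lemma measurableSet_killed (Λ : Finset (Zd d)) (x : Zd d) :
    MeasurableSet {p : ℝ × PathSpace d | killed Λ p.2 p.1 = some x} := by
  obtain ⟨D, hDc, hD⟩ := TopologicalSpace.exists_countable_dense ℝ≥0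
  have key : {p : ℝ × PathSpace d | killed Λ p.2 p.1 = some x} =
      (⋂ q ∈ D, ({p : ℝ × PathSpace d | p.1.toNNReal ≤ q} ∪ {p | p.2.1 q ∈ Λ})) ∩
        ({p | p.2.1 p.1.toNNReal ∈ Λ} ∩ {p | p.2.1 p.1.toNNReal = x}) := by
    ext ⟨t, ω⟩
    simp only [mem_ofPred_eq, killed_eq_some_iff, mem_inter_iff, mem_iInter, mem_union]
    constructor
    · rintro ⟨h1, h2⟩
      refine ⟨fun q _ => ?_, h1 _ le_rfl, h2⟩
      rcases le_total t.toNNReal q with h | h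
      · exact .inl h
      · exact .inr (h1 q h)
    · rintro ⟨h1, h2, h3⟩
      refine ⟨fun s hs => ?_, h3⟩
      rcases hs.eq_or_lt with rfl | hs
      · exact h2
      obtain ⟨u, hu, hc⟩ := exists_right_eq ω s
      obtain ⟨q, hq, hq1, hq2⟩ := hD.exists_between (lt_min hu hs)
      rw [← hc q hq1.le (hq2.trans_le (min_le_left _ _))]
      exact (h1 q hq).resolve_left (not_le.2 (hq2.trans_le (min_le_right _ _)))
  rw [key]
  have hm : Measurable (fun p : ℝ × PathSpace d => p.2.1 p.1.toNNReal) :=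
    measurable_eval.comp ((measurable_real_toNNReal.comp measurable_fst).prodMk measurable_snd)
  refine (MeasurableSet.biInter hDc fun q _ => ?_).inter
    ((hm (Set.toFinite (Λ : Set (Zd d))).measurableSet).inter (hm (measurableSet_singleton x)))
  exact (measurableSet_le (measurable_real_toNNReal.comp measurable_fst) measurable_const).union
    (((measurable_coord q).comp measurable_snd) (Set.toFinite (Λ : Set (Zd d))).measurableSet)

/-! ### Local times -/

lemma integrableOn_killed_indicator (Λ : Finset (Zd d)) (ω : PathSpace d) (x : Zd d) (s t : ℝ) :
    IntegrableOn (({s | killed Λ ω s = some x} : Set ℝ).indicator (1 : ℝ → ℝ)) (Icc s t) := by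
  have hf : Measurable (fun s : ℝ => (s, ω)) := by fun_prop
  have hm : MeasurableSet {s | killed Λ ω s = some x} := hf (measurableSet_killed Λ x)
  exact (integrableOn_const (C := (1 : ℝ)) (by simp)).indicator hm

lemma localTime_mem_orthant (Λ : Finset (Zd d)) (ω : PathSpace d) (I : Set ℝ) :
    localTime Λ ω I ∈ orthant Λ := fun _ =>
  integral_nonneg fun _ => indicator_nonneg (fun _ _ => zero_le_one) _

lemma localTime_add {Λ : Finset (Zd d)} (ω : PathSpace d) {s u t : ℝ} (h1 : s ≤ u) (h2 : u ≤ t) :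
    localTime Λ ω (Icc s t) = localTime Λ ω (Icc s u) + localTime Λ ω (Icc u t) := by
  ext x
  have := intervalIntegral.integral_add_adjacent_intervals
    (f := ({s | killed Λ ω s = some x.1} : Set ℝ).indicator (1 : ℝ → ℝ)) (μ := volume)
    (a := s) (b := u) (c := t)
    ((intervalIntegrable_iff_integrableOn_Icc_of_le h1).2 (integrableOn_killed_indicator ..))
    ((intervalIntegrable_iff_integrableOn_Icc_of_le h2).2 (integrableOn_killed_indicator ..))
  rw [intervalIntegral.integral_of_le h1, intervalIntegral.integral_of_le h2,
    intervalIntegral.integral_of_le (h1.trans h2)] at this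
  simp only [← integral_Icc_eq_integral_Ioc] at this
  exact this.symm

lemma localTime_self {Λ : Finset (Zd d)} (ω : PathSpace d) (s : ℝ) :
    localTime Λ ω (Icc s s) = 0 := by
  ext x; simp [localTime]

lemma localTime_congr {Λ : Finset (Zd d)} {ω ω' : PathSpace d} {s t : ℝ}
    (h : ∀ u, s ≤ u → u ≤ t → ∀ x : Λ, (killed Λ ω u = some x.1 ↔ killed Λ ω' u = some x.1)) :
    localTime Λ ω (Icc s t) = localTime Λ ω' (Icc s t) := by
  ext x
  refine setIntegral_congr_fun measurableSet_Icc fun u hu => ?_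
  have := h u hu.1 hu.2 x
  by_cases hk : killed Λ ω' u = some x.1 <;> simp [indicator, this, hk]

lemma localTime_of_const {Λ : Finset (Zd d)} {ω : PathSpace d} {s t : ℝ} (hst : s ≤ t) {a : Λ}
    (h : ∀ u, s < u → u < t → killed Λ ω u = some a.1) :
    localTime Λ ω (Icc s t) = (t - s) • Pi.single a 1 := by
  ext x
  have h0 : localTime Λ ω (Icc s t) x = ∫ u in Ioo s t, (Pi.single a (1 : ℝ) : Λ → ℝ) x := by
    unfold localTime
    rw [integral_Icc_eq_integral_Ioo]
    refine setIntegral_congr_fun measurableSet_Ioo fun u hu => ?_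
    simp only [indicator, mem_ofPred_eq, h u hu.1 hu.2, Option.some_inj, Pi.single_apply,
      Pi.one_apply, eq_comm, Subtype.ext_iff]
  rw [h0]
  simp [hst]

lemma measurable_localTime (Λ : Finset (Zd d)) :
    Measurable (fun p : (ℝ × ℝ) × PathSpace d => localTime Λ p.2 (Icc p.1.1 p.1.2)) := by
  refine measurable_pi_lambda _ fun x => ?_
  let S : Set (((ℝ × ℝ) × PathSpace d) × ℝ) :=
    {q | q.1.1.1 ≤ q.2 ∧ q.2 ≤ q.1.1.2} ∩ {q | killed Λ q.1.2 q.2 = some x.1}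
  have hS : MeasurableSet S := by
    have hg : Measurable (fun q : ((ℝ × ℝ) × PathSpace d) × ℝ => (q.2, q.1.2)) := by fun_prop
    refine MeasurableSet.inter ?_ (hg (measurableSet_killed Λ x.1))
    have h1 : MeasurableSet {q : ((ℝ × ℝ) × PathSpace d) × ℝ | q.1.1.1 ≤ q.2} :=
      measurableSet_le (by fun_prop) (by fun_prop)
    have h2 : MeasurableSet {q : ((ℝ × ℝ) × PathSpace d) × ℝ | q.2 ≤ q.1.1.2} :=
      measurableSet_le (by fun_prop) (by fun_prop)
    exact h1.inter h2
  let f : ((ℝ × ℝ) × PathSpace d) × ℝ → ℝ := S.indicator 1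
  have hf : Measurable f := measurable_one.indicator hS
  have h : ∀ p : (ℝ × ℝ) × PathSpace d, localTime Λ p.2 (Icc p.1.1 p.1.2) x =
      ∫ ℓ, f (p, ℓ) := by
    intro p
    unfold localTime
    rw [← integral_indicator measurableSet_Icc]
    congr 1
    ext ℓ
    by_cases h1 : killed Λ p.2 ℓ = some x.1 <;> by_cases h2 : ℓ ∈ Icc p.1.1 p.1.2 <;>
      simp_all [f, S, indicator]
  simp_rw [h]
  exact (StronglyMeasurable.integral_prod_right (f := fun p ℓ => f (p, ℓ))
    hf.stronglyMeasurable).measurable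

/-! ### The Markov property on path space -/

/-- The path after time `u`. -/
def shiftPath (u : ℝ≥0) (ω : PathSpace d) : PathSpace d :=
  ⟨fun t => ω.1 (u + t), by
    refine ⟨fun t => ?_, fun t => ?_⟩
    · refine ContinuousWithinAt.comp (t := Ici (u + t)) (ω.2.1 (u + t)) (by fun_prop) ?_
      intro s hs
      exact add_le_add_right hs u
    · obtain ⟨l, hl⟩ := ω.2.2 (u + t)
      refine ⟨l, hl.comp (tendsto_nhdsWithin_iff.2 ⟨?_, ?_⟩)⟩
      · exact ((continuous_const.add continuous_id).tendsto t).mono_left nhdsWithin_le_nhds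
      · filter_upwards [self_mem_nhdsWithin] with s hs
        exact add_lt_add_right (mem_Iio.1 hs) u⟩

/-- The path stopped at time `u`. -/
def stopPath (u : ℝ≥0) (ω : PathSpace d) : PathSpace d :=
  ⟨fun t => ω.1 (min t u), by
    refine ⟨fun t => ?_, fun t => ?_⟩
    · refine ContinuousWithinAt.comp (t := Ici (min t u)) (ω.2.1 (min t u)) (by fun_prop) ?_
      intro s hs
      exact min_le_min_right u hs
    · rcases le_or_gt t u with h | h
      · obtain ⟨l, hl⟩ := ω.2.2 t
        refine ⟨l, hl.congr' ?_⟩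
        filter_upwards [self_mem_nhdsWithin] with s hs
        rw [min_eq_left ((mem_Iio.1 hs).le.trans h)]
      · refine ⟨ω.1 u, tendsto_const_nhds.congr' ?_⟩
        filter_upwards [nhdsWithin_le_nhds (lt_mem_nhds h)] with s hs
        rw [min_eq_right hs.le]⟩

lemma measurable_shiftPath (u : ℝ≥0) : Measurable (shiftPath (d := d) u) :=
  (measurable_pi_lambda _ fun t => measurable_coord (u + t)).subtype_mk

lemma measurable_stopPath (u : ℝ≥0) : Measurable (stopPath (d := d) u) :=
  (measurable_pi_lambda _ fun t => measurable_coord (min t u)).subtype_mk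

lemma Jplus_nonneg {J : Zd d → ℝ} (hJ : IsJumpFunction J) (x : Zd d) : 0 ≤ Jplus J x :=
  indicator_nonneg (fun _ hx => hJ.nonneg _ hx) _

lemma convPow_nonneg {f : Zd d → ℝ} (hf : ∀ x, 0 ≤ f x) (n : ℕ) (x : Zd d) :
    0 ≤ convPow f n x := by
  induction n generalizing x with
  | zero => exact indicator_nonneg (fun _ _ => zero_le_one) _
  | succ n ih => exact tsum_nonneg fun y => mul_nonneg (hf y) (ih _)

lemma transProb_nonneg {J : Zd d → ℝ} (hJ : IsJumpFunction J) {t : ℝ} (ht : 0 ≤ t) (x : Zd d) :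
    0 ≤ transProb J t x :=
  tsum_nonneg fun n => mul_nonneg (by positivity) (convPow_nonneg (Jplus_nonneg hJ) n x)

/-- Monotone enumeration of a finite set of times that contains `0`. -/
lemma exists_monotone_enum (T : Finset ℝ≥0) (h0 : 0 ∈ T) :
    ∃ (n : ℕ) (t : ℕ → ℝ≥0), t 0 = 0 ∧ Monotone t ∧ ∀ s, s ∈ T ↔ ∃ i ≤ n, t i = s := by
  have hc : T.card = (T.card - 1) + 1 := (Nat.sub_add_cancel (Finset.card_pos.2 ⟨0, h0⟩)).symm
  set n := T.card - 1
  let e := T.orderEmbOfFin hc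
  let t : ℕ → ℝ≥0 := fun i => e ⟨min i n, by omega⟩
  have ht : Monotone t := fun i j hij => e.monotone (by simp [Fin.le_def]; omega)
  have hmem : ∀ s, s ∈ T ↔ ∃ i ≤ n, t i = s := by
    intro s
    rw [← Finset.mem_coe, ← T.range_orderEmbOfFin hc]
    constructor
    · rintro ⟨i, rfl⟩
      refine ⟨i, by omega, ?_⟩
      simp only [t, e]
      congr 1
      ext
      simp
      omega
    · rintro ⟨i, -, rfl⟩
      exact ⟨_, rfl⟩
  refine ⟨n, t, ?_, ht, hmem⟩
  obtain ⟨i, -, hi⟩ := (hmem 0).1 h0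
  exact le_antisymm ((ht (Nat.zero_le i)).trans hi.le) zero_le

/-- The cylinder of paths that agree with `x` at the times in `T`. -/
def cyl (T : Finset ℝ≥0) (x : ℝ≥0 → Zd d) : Set (PathSpace d) := {ω | ∀ s ∈ T, ω.1 s = x s}

lemma measurableSet_cyl (T : Finset ℝ≥0) (x : ℝ≥0 → Zd d) : MeasurableSet (cyl T x) := by
  have : cyl T x = ⋂ s ∈ T, {ω : PathSpace d | ω.1 s = x s} := by ext ω; simp [cyl]
  rw [this]
  exact Finset.measurableSet_biInter _ fun s _ => measurable_coord s (measurableSet_singleton _)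

/-- The walk with law `P a` starts at `a`, in terms of cylinders. -/
lemma IsWalkLaw.start {J : Zd d → ℝ} {P : Zd d → Measure (PathSpace d)} (hP : IsWalkLaw J P)
    (a z : Zd d) (T : Finset ℝ≥0) (hT : 0 ∈ T) (x : ℝ≥0 → Zd d) (hx : x 0 = z) (hz : z ≠ a) :
    P a (cyl T x) = 0 := by
  refine measure_mono_null (t := {ω | ∀ i ≤ 0, ω.1 ((fun _ => 0) i) = (fun _ => z) i}) ?_ ?_
  · intro ω hω i _
    exact (hω 0 hT).trans hx
  · rw [hP.fdd a 0 (fun _ => 0) (fun _ => z) rfl monotone_const]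
    simp [hz]

/-- The Markov property at time `u`, for cylinders. -/
lemma IsWalkLaw.markov_cyl {J : Zd d → ℝ} (hJ : IsJumpFunction J)
    {P : Zd d → Measure (PathSpace d)} (hP : IsWalkLaw J P) (a : Zd d) (u : ℝ≥0)
    (T₁ T₂ : Finset ℝ≥0) (h1 : 0 ∈ T₁) (hu : u ∈ T₁) (hle : ∀ s ∈ T₁, s ≤ u) (h2 : 0 ∈ T₂)
    (x₁ x₂ : ℝ≥0 → Zd d) (hx : x₁ u = x₂ 0) :
    P a (cyl T₁ x₁ ∩ shiftPath u ⁻¹' cyl T₂ x₂) = P a (cyl T₁ x₁) * P (x₂ 0) (cyl T₂ x₂) := by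
  obtain ⟨n₁, t₁, h10, m1, e1⟩ := exists_monotone_enum T₁ h1
  obtain ⟨n₂, t₂, h20, m2, e2⟩ := exists_monotone_enum T₂ h2
  have htn : t₁ n₁ = u := by
    refine le_antisymm (hle _ ((e1 _).2 ⟨n₁, le_rfl, rfl⟩)) ?_
    obtain ⟨i, hi, hiu⟩ := (e1 u).1 hu
    exact hiu ▸ m1 hi
  have c1 : cyl T₁ x₁ = {ω | ∀ i ≤ n₁, ω.1 (t₁ i) = x₁ (t₁ i)} := by
    ext ω
    exact ⟨fun h i hi => h _ ((e1 _).2 ⟨i, hi, rfl⟩), fun h s hs => by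
      obtain ⟨i, hi, rfl⟩ := (e1 s).1 hs; exact h i hi⟩
  have c2 : cyl T₂ x₂ = {ω | ∀ i ≤ n₂, ω.1 (t₂ i) = x₂ (t₂ i)} := by
    ext ω
    exact ⟨fun h i hi => h _ ((e2 _).2 ⟨i, hi, rfl⟩), fun h s hs => by
      obtain ⟨i, hi, rfl⟩ := (e2 s).1 hs; exact h i hi⟩
  -- the concatenated sequence of times and of values
  let t : ℕ → ℝ≥0 := fun i => if i ≤ n₁ then t₁ i else u + t₂ (i - n₁)
  let x : ℕ → Zd d := fun i => if i ≤ n₁ then x₁ (t₁ i) else x₂ (t₂ (i - n₁))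
  have tl : ∀ i ≤ n₁, t i = t₁ i := fun i hi => if_pos hi
  have xl : ∀ i ≤ n₁, x i = x₁ (t₁ i) := fun i hi => if_pos hi
  have tr : ∀ j, t (n₁ + j) = u + t₂ j := by
    intro j
    rcases j.eq_zero_or_pos with rfl | hj
    · simp [t, htn, h20]
    · simp [t, hj.ne']
  have xr : ∀ j, x (n₁ + j) = x₂ (t₂ j) := by
    intro j
    rcases j.eq_zero_or_pos with rfl | hj
    · simp [x, htn, h20, hx]
    · simp [x, hj.ne']
  have tm : Monotone t := by
    refine monotone_nat_of_le_succ fun i => ?_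
    rcases lt_or_ge i n₁ with hi | hi
    · rw [tl i hi.le, tl (i + 1) hi]
      exact m1 i.le_succ
    · obtain ⟨j, rfl⟩ := Nat.exists_eq_add_of_le hi
      rw [add_assoc, tr, tr]
      gcongr
      exact m2 j.le_succ
  have c12 : cyl T₁ x₁ ∩ shiftPath u ⁻¹' cyl T₂ x₂ = {ω | ∀ i ≤ n₁ + n₂, ω.1 (t i) = x i} := by
    ext ω
    rw [c1, c2]
    constructor
    · rintro ⟨ha, hb⟩ i hi
      rcases le_total i n₁ with h | h
      · rw [tl i h, xl i h]; exact ha i h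
      · obtain ⟨j, rfl⟩ := Nat.exists_eq_add_of_le h
        rw [tr, xr]
        exact hb j (by omega)
    · intro h
      refine ⟨fun i hi => ?_, fun j hj => ?_⟩
      · have := h i (by omega)
        rwa [tl i hi, xl i hi] at this
      · have := h (n₁ + j) (by omega)
        rw [tr, xr] at this
        exact this
  rw [c12, c1, c2, hP.fdd a _ t x (by rw [tl 0 (by omega), h10]) tm,
    hP.fdd a _ t₁ (fun i => x₁ (t₁ i)) h10 m1, hP.fdd _ _ t₂ (fun i => x₂ (t₂ i)) h20 m2,
    Finset.prod_range_add, ← mul_assoc, ENNReal.ofReal_mul, xl 0 (by omega)]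
  · congr 2
    · congr 1
      refine Finset.prod_congr rfl fun i hi => ?_
      have hi := Finset.mem_range.1 hi
      rw [tl i hi.le, tl (i + 1) hi, xl i hi.le, xl (i + 1) hi]
    · rw [h20]
      simp only [mem_singleton_iff, indicator_of_mem, Pi.one_apply, one_mul]
      refine Finset.prod_congr rfl fun j _ => ?_
      rw [add_assoc, tr, tr, xr, xr]
      push_cast
      congr 1
      ring
  · refine mul_nonneg (indicator_nonneg (fun _ _ => zero_le_one) _)
      (Finset.prod_nonneg fun i _ => transProb_nonneg hJ ?_ _)
    exact sub_nonneg.2 (by exact_mod_cast tm i.le_succ)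

/-- The cylinders that fix the value at time `0`, and the empty set: a π-system that generates the
σ-algebra of the path space. -/
def cylinders (d : ℕ) : Set (Set (PathSpace d)) :=
  {∅} ∪ {A | ∃ (T : Finset ℝ≥0) (x : ℝ≥0 → Zd d), 0 ∈ T ∧ A = cyl T x}

lemma isPiSystem_cylinders : IsPiSystem (cylinders d) := by
  rintro A hA B hB ⟨ω, hωA, hωB⟩
  rcases hA with rfl | ⟨T, x, hT, rfl⟩
  · exact absurd hωA (notMem_empty _)
  rcases hB with rfl | ⟨T', x', hT', rfl⟩
  · exact absurd hωB (notMem_empty _)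
  classical
  refine .inr ⟨T ∪ T', ω.1, Finset.mem_union_left _ hT, ?_⟩
  ext η
  simp only [cyl, mem_inter_iff, mem_ofPred_eq, Finset.mem_union] at hωA hωB ⊢
  constructor
  · rintro ⟨h1, h2⟩ s (hs | hs)
    · rw [h1 s hs, hωA s hs]
    · rw [h2 s hs, hωB s hs]
  · exact fun h => ⟨fun s hs => (h s (.inl hs)).trans (hωA s hs),
      fun s hs => (h s (.inr hs)).trans (hωB s hs)⟩

lemma generateFrom_cylinders :
    MeasurableSpace.generateFrom (cylinders d) =
      (inferInstance : MeasurableSpace (PathSpace d)) := by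
  apply le_antisymm
  · refine MeasurableSpace.generateFrom_le ?_
    rintro A (rfl | ⟨T, x, -, rfl⟩)
    · exact MeasurableSet.empty
    · exact measurableSet_cyl T x
  · have hcoord : ∀ t : ℝ≥0, Measurable[MeasurableSpace.generateFrom (cylinders d)]
        (fun ω : PathSpace d => ω.1 t) := by
      intro t
      refine @measurable_to_countable' _ _ _ _ (MeasurableSpace.generateFrom (cylinders d)) _
        fun z => ?_
      have : (fun ω : PathSpace d => ω.1 t) ⁻¹' {z} = ⋃ z₀ : Zd d,
          cyl {0, t} (fun s => if s = t then z else z₀) := by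
        ext ω
        simp only [cyl, mem_preimage, mem_singleton_iff, mem_iUnion, mem_ofPred_eq,
          Finset.mem_insert, Finset.mem_singleton]
        constructor
        · intro h
          refine ⟨ω.1 0, ?_⟩
          rintro s (rfl | rfl)
          · by_cases hs : (0 : ℝ≥0) = t
            · simp [hs, h]
            · simp [hs]
          · simp [h]
        · rintro ⟨z₀, h⟩
          simpa using h t (.inr rfl)
      rw [this]
      refine MeasurableSet.iUnion fun z₀ => ?_
      exact MeasurableSpace.measurableSet_generateFrom (.inr ⟨_, _, by simp, rfl⟩)
    refine Measurable.comap_le (f := (Subtype.val : PathSpace d → _)) ?_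
    exact @measurable_pi_lambda _ _ _ (MeasurableSpace.generateFrom (cylinders d)) _ _ hcoord

/-- The path space is a countable union of cylinders. -/
noncomputable def cylindersSpanning (μ : Measure (PathSpace d)) [IsFiniteMeasure μ] :
    μ.FiniteSpanningSetsIn (cylinders d) where
  set n := cyl {0} (fun _ => (exists_surjective_nat (Zd d)).choose n)
  set_mem n := .inr ⟨_, _, by simp, rfl⟩
  finite n := measure_lt_top _ _
  spanning := by
    refine eq_univ_of_forall fun ω => mem_iUnion.2 ?_
    obtain ⟨n, hn⟩ := (exists_surjective_nat (Zd d)).choose_spec (ω.1 0)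
    exact ⟨n, by simp [cyl, hn]⟩

/-- The Markov property at time `u`: on the event that the walk is at `b` at time `u`, the stopped
path and the path after time `u` are independent and the latter has law `P b`. -/
theorem IsWalkLaw.markov {J : Zd d → ℝ} (hJ : IsJumpFunction J)
    {P : Zd d → Measure (PathSpace d)} (hP : IsWalkLaw J P) (a b : Zd d) (u : ℝ≥0) :
    ((P a).restrict {ω | ω.1 u = b}).map (fun ω => (stopPath u ω, shiftPath u ω)) =
      (((P a).restrict {ω | ω.1 u = b}).map (stopPath u)).prod (P b) := by
  have := hP.prob
  have hmb : MeasurableSet {ω : PathSpace d | ω.1 u = b} :=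
    measurable_coord u (measurableSet_singleton b)
  symm
  refine Measure.prod_eq_generateFrom generateFrom_cylinders generateFrom_cylinders
    isPiSystem_cylinders isPiSystem_cylinders (cylindersSpanning _) (cylindersSpanning _) ?_
  rintro A (rfl | ⟨T₁, x₁, h1, rfl⟩) B (rfl | ⟨T₂, x₂, h2, rfl⟩)
  · simp
  · simp
  · simp
  rw [Measure.map_apply ((measurable_stopPath u).prodMk (measurable_shiftPath u))
    ((measurableSet_cyl _ _).prod (measurableSet_cyl _ _)),
    Measure.map_apply (measurable_stopPath u) (measurableSet_cyl _ _),
    Measure.restrict_apply (((measurable_stopPath u).prodMk (measurable_shiftPath u))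
      ((measurableSet_cyl _ _).prod (measurableSet_cyl _ _))),
    Measure.restrict_apply ((measurable_stopPath u) (measurableSet_cyl _ _))]
  have hset : (fun ω => (stopPath u ω, shiftPath u ω)) ⁻¹' cyl T₁ x₁ ×ˢ cyl T₂ x₂ ∩
      {ω : PathSpace d | ω.1 u = b} = (stopPath u ⁻¹' cyl T₁ x₁ ∩ {ω | ω.1 u = b}) ∩
        shiftPath u ⁻¹' cyl T₂ x₂ := by
    ext ω
    simp only [mem_inter_iff, mem_preimage, mem_prod]
    tauto
  rw [hset]
  rcases (stopPath u ⁻¹' cyl T₁ x₁ ∩ {ω : PathSpace d | ω.1 u = b}).eq_empty_or_nonempty with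
    he | ⟨ω₀, hω₀, hb⟩
  · rw [he]; simp
  by_cases hx : x₂ 0 = b
  · -- the event before `u` is a cylinder based on times up to `u`
    have hpast : stopPath u ⁻¹' cyl T₁ x₁ ∩ {ω : PathSpace d | ω.1 u = b} =
        cyl (insert u (T₁.image fun s => min s u)) ω₀.1 := by
      ext ω
      simp only [cyl, stopPath, mem_inter_iff, mem_preimage, mem_ofPred_eq, Finset.mem_insert,
        Finset.mem_image] at hω₀ hb ⊢
      constructor
      · rintro ⟨h, h'⟩ s (rfl | ⟨r, hr, rfl⟩)
        · rw [h', hb]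
        · rw [h r hr, hω₀ r hr]
      · intro h
        exact ⟨fun s hs => (h _ (.inr ⟨s, hs, rfl⟩)).trans (hω₀ s hs), (h u (.inl rfl)).trans hb⟩
    rw [hpast, hP.markov_cyl hJ a u _ T₂ _ (by simp) _ h2 ω₀.1 x₂ (hb.trans hx.symm), hx]
    · exact Finset.mem_insert_of_mem (Finset.mem_image.2 ⟨0, h1, by simp⟩)
    · intro s hs
      rcases Finset.mem_insert.1 hs with rfl | hs
      · exact le_rfl
      · obtain ⟨r, -, rfl⟩ := Finset.mem_image.1 hs
        exact min_le_right _ _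
  · rw [hP.start b (x₂ 0) T₂ h2 x₂ rfl hx, mul_zero]
    refine measure_mono_null (t := ∅) ?_ measure_empty
    rintro ω ⟨⟨-, hb⟩, h⟩
    have := h 0 h2
    simp only [shiftPath, add_zero] at this
    exact hx (this.symm.trans hb)

/-- The Markov property at time `u`, for functionals of the stopped path and the path after `u`. -/
lemma IsWalkLaw.lintegral_markov {J : Zd d → ℝ} (hJ : IsJumpFunction J)
    {P : Zd d → Measure (PathSpace d)} (hP : IsWalkLaw J P) (a b : Zd d) (u : ℝ≥0)
    (f : PathSpace d × PathSpace d → ℝ≥0∞) (hf : Measurable f) :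
    ∫⁻ ω in {ω | ω.1 u = b}, f (stopPath u ω, shiftPath u ω) ∂(P a) =
      ∫⁻ ω in {ω | ω.1 u = b}, ∫⁻ η, f (stopPath u ω, η) ∂(P b) ∂(P a) := by
  have := hP.prob
  rw [← lintegral_map (g := fun ω => (stopPath u ω, shiftPath u ω)) hf
      ((measurable_stopPath u).prodMk (measurable_shiftPath u)),
    hP.markov hJ, lintegral_prod _ hf.aemeasurable,
    lintegral_map hf.lintegral_prod_right' (measurable_stopPath u)]

/-! ### The killed walk and its local times under stopping and shifting -/

lemma killed_stopPath {Λ : Finset (Zd d)} {ω : PathSpace d} {u : ℝ≥0} {t : ℝ}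
    (h : t.toNNReal ≤ u) (x : Zd d) :
    killed Λ (stopPath u ω) t = some x ↔ killed Λ ω t = some x := by
  rw [killed_eq_some_iff, killed_eq_some_iff]
  have h1 : ∀ s ≤ t.toNNReal, (stopPath u ω).1 s = ω.1 s := fun s hs => by
    simp [stopPath, min_eq_left (hs.trans h)]
  rw [h1 _ le_rfl]
  exact and_congr_left fun _ => forall₂_congr fun s hs => by rw [h1 s hs]

lemma localTime_stopPath {Λ : Finset (Zd d)} (ω : PathSpace d) {u : ℝ≥0} {s t : ℝ}
    (h : t ≤ u) : localTime Λ (stopPath u ω) (Icc s t) = localTime Λ ω (Icc s t) :=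
  localTime_congr fun _ _ hr x =>
    killed_stopPath (Real.toNNReal_le_iff_le_coe.2 (hr.trans h)) x.1

lemma killed_shiftPath {Λ : Finset (Zd d)} {ω : PathSpace d} {u : ℝ≥0} {z : Zd d}
    (h : killed Λ ω u = some z) {ℓ : ℝ} (hℓ : 0 ≤ ℓ) (x : Zd d) :
    killed Λ (shiftPath u ω) ℓ = some x ↔ killed Λ ω (u + ℓ) = some x := by
  rw [killed_eq_some_iff, Real.toNNReal_coe] at h
  rw [killed_eq_some_iff, killed_eq_some_iff, Real.toNNReal_add u.coe_nonneg hℓ, Real.toNNReal_coe]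
  refine and_congr ⟨fun H s hs => ?_, fun H s hs => H _ (by gcongr)⟩ Iff.rfl
  rcases le_total s u with hsu | hsu
  · exact h.1 s hsu
  · obtain ⟨r, rfl⟩ := exists_add_of_le hsu
    exact H r (le_of_add_le_add_left hs)

lemma localTime_shiftPath {Λ : Finset (Zd d)} {ω : PathSpace d} {u : ℝ≥0} {z : Zd d}
    (h : killed Λ ω u = some z) {ℓ : ℝ} (hℓ : 0 ≤ ℓ) :
    localTime Λ (shiftPath u ω) (Icc 0 ℓ) = localTime Λ ω (Icc u (u + ℓ)) := by
  ext x
  have h1 := intervalIntegral.integral_comp_add_left (a := 0) (b := ℓ)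
    (({s | killed Λ ω s = some x.1} : Set ℝ).indicator (1 : ℝ → ℝ)) (u : ℝ)
  rw [add_zero, intervalIntegral.integral_of_le hℓ,
    intervalIntegral.integral_of_le (by simpa using hℓ), ← integral_Icc_eq_integral_Ioc,
    ← integral_Icc_eq_integral_Ioc] at h1
  refine Eq.trans ?_ h1
  refine setIntegral_congr_fun measurableSet_Icc fun r hr => ?_
  have := killed_shiftPath h hr.1 x.1
  by_cases hk : killed Λ ω (u + r) = some x.1 <;> simp [indicator, this, hk]

/-! ### Weights of walks through prescribed points at prescribed times -/

/-- The factor of a walk that is at `z` at time `t`, having started to collect local time at time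
`b`, for the step from time `s` to time `t`. -/
noncomputable def stepWeight (Λ : Finset (Zd d)) (Z : (Λ → ℝ) → ℝ) (z : Λ) (b s t : ℝ)
    (ω : PathSpace d) : ℝ≥0∞ :=
  ({ω' | killed Λ ω' t = some z.1} : Set (PathSpace d)).indicator
    (fun ω' => ENNReal.ofReal (Z (localTime Λ ω' (Icc b t)) / Z (localTime Λ ω' (Icc b s)))) ω

/-- The weight of a walk that visits `z 0, …, z n` at the times `t 0, …, t n`. The step from
`t k` to `t (k + 1)` is weighted by a ratio of values of `Z` at the local times collected since
the earlier time `t (β k)`. -/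
noncomputable def walkWeight (Λ : Finset (Zd d)) (Z : (Λ → ℝ) → ℝ) (β : ℕ → ℕ) (z : ℕ → Λ)
    (t : ℕ → ℝ) (n : ℕ) (ω : PathSpace d) : ℝ≥0∞ :=
  ({ω' | killed Λ ω' (t 0) = some (z 0).1} : Set (PathSpace d)).indicator 1 ω *
    ∏ k ∈ Finset.range n, stepWeight Λ Z (z (k + 1)) (t (β k)) (t k) (t (k + 1)) ω

lemma walkWeight_succ (Λ : Finset (Zd d)) (Z : (Λ → ℝ) → ℝ) (β : ℕ → ℕ) (z : ℕ → Λ)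
    (t : ℕ → ℝ) (n : ℕ) (ω : PathSpace d) :
    walkWeight Λ Z β z t (n + 1) ω =
      walkWeight Λ Z β z t n ω * stepWeight Λ Z (z (n + 1)) (t (β n)) (t n) (t (n + 1)) ω := by
  simp only [walkWeight, Finset.prod_range_succ, mul_assoc]

lemma walkWeight_eq_zero {Λ : Finset (Zd d)} {Z : (Λ → ℝ) → ℝ} {β : ℕ → ℕ} {z : ℕ → Λ}
    {t : ℕ → ℝ} {n : ℕ} {ω : PathSpace d} (h : killed Λ ω (t n) ≠ some (z n).1) :
    walkWeight Λ Z β z t n ω = 0 := by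
  cases n with
  | zero => simp [walkWeight, h]
  | succ n => simp [walkWeight_succ, stepWeight, h]

lemma walkWeight_congr {Λ : Finset (Zd d)} {Z : (Λ → ℝ) → ℝ} {β : ℕ → ℕ} (hβ : ∀ k, β k ≤ k)
    {z : ℕ → Λ} {t t' : ℕ → ℝ} {n : ℕ} (h : ∀ k ≤ n, t k = t' k) (ω : PathSpace d) :
    walkWeight Λ Z β z t n ω = walkWeight Λ Z β z t' n ω := by
  unfold walkWeight
  rw [h 0 n.zero_le]
  congr 1
  refine Finset.prod_congr rfl fun k hk => ?_
  have hk := Finset.mem_range.1 hk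
  rw [h k hk.le, h (k + 1) hk, h (β k) ((hβ k).trans hk.le)]

lemma walkWeight_stopPath {Λ : Finset (Zd d)} {Z : (Λ → ℝ) → ℝ} {β : ℕ → ℕ} {z : ℕ → Λ}
    {t : ℕ → ℝ} {n : ℕ} {u : ℝ≥0} (h : ∀ k ≤ n, t k ≤ u) (ω : PathSpace d) :
    walkWeight Λ Z β z t n (stopPath u ω) = walkWeight Λ Z β z t n ω := by
  have hk : ∀ k ≤ n, ∀ x, killed Λ (stopPath u ω) (t k) = some x ↔ killed Λ ω (t k) = some x :=
    fun k hk x => killed_stopPath (Real.toNNReal_le_iff_le_coe.2 (h k hk)) x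
  unfold walkWeight stepWeight
  congr 1
  · simp only [indicator, mem_ofPred_eq, hk 0 n.zero_le, Pi.one_apply]
  · refine Finset.prod_congr rfl fun k hkn => ?_
    have hkn := Finset.mem_range.1 hkn
    simp only [indicator, mem_ofPred_eq, hk (k + 1) hkn, localTime_stopPath ω (h k hkn.le),
      localTime_stopPath ω (h (k + 1) hkn)]

section Measurability

variable {α : Type*} [MeasurableSpace α] {Λ : Finset (Zd d)}

lemma measurableSet_killed_comp {t : α → ℝ} {p : α → PathSpace d} (ht : Measurable t)
    (hp : Measurable p) (x : Zd d) : MeasurableSet {a | killed Λ (p a) (t a) = some x} :=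
  (ht.prodMk hp) (measurableSet_killed Λ x)

lemma measurable_localTime_comp {s t : α → ℝ} {p : α → PathSpace d} (hs : Measurable s)
    (ht : Measurable t) (hp : Measurable p) :
    Measurable fun a => localTime Λ (p a) (Icc (s a) (t a)) :=
  (measurable_localTime Λ).comp ((hs.prodMk ht).prodMk hp)

lemma measurable_walkWeight {Z : (Λ → ℝ) → ℝ} (hZ : Measurable Z) (β : ℕ → ℕ) (z : ℕ → Λ)
    {t : α → ℕ → ℝ} (ht : ∀ k, Measurable fun a => t a k) {p : α → PathSpace d}
    (hp : Measurable p) (n : ℕ) :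
    Measurable fun a => walkWeight Λ Z β z (t a) n (p a) := by
  unfold walkWeight stepWeight
  refine Measurable.mul ?_ (Finset.measurable_fun_prod _ fun k _ => ?_)
  · exact (measurable_one (α := ℝ≥0∞)).indicator (measurableSet_killed_comp (ht 0) hp (z 0).1)
  · have h : Measurable fun a => ENNReal.ofReal
        (Z (localTime Λ (p a) (Icc (t a (β k)) (t a (k + 1)))) /
          Z (localTime Λ (p a) (Icc (t a (β k)) (t a k)))) :=
      ((hZ.comp (measurable_localTime_comp (ht _) (ht _) hp)).div
        (hZ.comp (measurable_localTime_comp (ht _) (ht _) hp))).ennreal_ofReal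
    exact h.indicator (measurableSet_killed_comp (ht (k + 1)) hp (z (k + 1)).1)

end Measurability

/-- The integrand of the Green's function `G_𝐭(a,b)`: the weight of a path that is at `b` at time
`ℓ`. -/
noncomputable def greenIntegrand (Λ : Finset (Zd d)) (Z : (Λ → ℝ) → ℝ) (b : Λ) (t : Λ → ℝ) (ℓ : ℝ)
    (ω : PathSpace d) : ℝ≥0∞ :=
  ({ω' | killed Λ ω' ℓ = some b.1} : Set (PathSpace d)).indicator
    (fun ω' => ENNReal.ofReal (Z (t + localTime Λ ω' (Icc 0 ℓ)) / Z t)) ω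

lemma measurable_greenIntegrand {α : Type*} [MeasurableSpace α] {Λ : Finset (Zd d)}
    {Z : (Λ → ℝ) → ℝ} (hZ : Measurable Z) (b : Λ) {t : α → Λ → ℝ} (ht : Measurable t)
    {ℓ : α → ℝ} (hℓ : Measurable ℓ) {p : α → PathSpace d} (hp : Measurable p) :
    Measurable fun a => greenIntegrand Λ Z b (t a) (ℓ a) (p a) := by
  have h : Measurable fun a => ENNReal.ofReal
      (Z (t a + localTime Λ (p a) (Icc 0 (ℓ a))) / Z (t a)) :=
    ((hZ.comp (ht.add (measurable_localTime_comp measurable_const hℓ hp))).div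
      (hZ.comp ht)).ennreal_ofReal
  exact h.indicator (measurableSet_killed_comp hℓ hp b.1)

/-- A weight `W` and a local time `T` that are determined by the path up to time `u`, followed by
a walk from `a` to `b`: by the Markov property, integration over the duration of the second walk
produces the Green's function `G_T(a,b)`. -/
lemma lintegral_mul_greenIntegrand_le {J : Zd d → ℝ} (hJ : IsJumpFunction J)
    {P : Zd d → Measure (PathSpace d)} (hP : IsWalkLaw J P) {Λ : Finset (Zd d)}
    {Z : (Λ → ℝ) → ℝ} (hZ : Measurable Z)
    (hG : ∀ t ∈ orthant Λ, ∀ a b : Λ, greenE Λ Z P t a b ≤ greenE Λ Z P 0 a b)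
    (x : Zd d) (a b : Λ) (u : ℝ≥0) {W : PathSpace d → ℝ≥0∞} (hW : Measurable W)
    {T : PathSpace d → Λ → ℝ} (hT : Measurable T) (hT0 : ∀ ω, T ω ∈ orthant Λ)
    (hWs : ∀ ω, W (stopPath u ω) = W ω) (hTs : ∀ ω, T (stopPath u ω) = T ω)
    (hW0 : ∀ ω, ω.1 u ≠ a.1 → W ω = 0) :
    ∫⁻ ℓ in Ioi 0, ∫⁻ ω, W ω * greenIntegrand Λ Z b (T ω) ℓ (shiftPath u ω) ∂(P x) ≤
      (∫⁻ ω, W ω ∂(P x)) * greenE Λ Z P 0 a b := by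
  have := hP.prob
  have hmb : MeasurableSet {ω : PathSpace d | ω.1 u = a.1} :=
    measurable_coord u (measurableSet_singleton _)
  have hrestr : ∀ F : PathSpace d → ℝ≥0∞, ∫⁻ ω, W ω * F ω ∂(P x) =
      ∫⁻ ω in {ω | ω.1 u = a.1}, W ω * F ω ∂(P x) := by
    intro F
    rw [← lintegral_indicator hmb]
    refine lintegral_congr fun ω => ?_
    by_cases hω : ω.1 u = a.1
    · rw [indicator_of_mem (s := {ω : PathSpace d | ω.1 u = a.1}) hω]
    · rw [indicator_of_notMem (s := {ω : PathSpace d | ω.1 u = a.1}) hω, hW0 ω hω, zero_mul]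
  have hinner : Measurable fun q : ℝ × PathSpace d =>
      ∫⁻ η, greenIntegrand Λ Z b (T q.2) q.1 η ∂(P a) := by
    refine Measurable.lintegral_prod_right' (f := fun q : (ℝ × PathSpace d) × PathSpace d =>
      greenIntegrand Λ Z b (T q.1.2) q.1.1 q.2) ?_
    exact measurable_greenIntegrand hZ b (by fun_prop) (by fun_prop) (by fun_prop)
  calc ∫⁻ ℓ in Ioi 0, ∫⁻ ω, W ω * greenIntegrand Λ Z b (T ω) ℓ (shiftPath u ω) ∂(P x)
      = ∫⁻ ℓ in Ioi 0, ∫⁻ ω in {ω | ω.1 u = a.1}, (W ω *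
          ∫⁻ η, greenIntegrand Λ Z b (T ω) ℓ η ∂(P a)) ∂(P x) := by
        refine lintegral_congr fun ℓ => ?_
        have hf : Measurable fun q : PathSpace d × PathSpace d =>
            W q.1 * greenIntegrand Λ Z b (T q.1) ℓ q.2 :=
          (hW.comp measurable_fst).mul
            (measurable_greenIntegrand hZ b (hT.comp measurable_fst) measurable_const
              measurable_snd)
        have hM := hP.lintegral_markov hJ x a.1 u _ hf
        simp only [hWs, hTs] at hM
        rw [hrestr, hM]
        refine lintegral_congr fun ω => ?_
        exact lintegral_const_mul (W ω)
          (measurable_greenIntegrand hZ b measurable_const measurable_const measurable_id)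
    _ = ∫⁻ ω in {ω | ω.1 u = a.1}, (W ω *
          ∫⁻ ℓ in Ioi 0, ∫⁻ η, greenIntegrand Λ Z b (T ω) ℓ η ∂(P a)) ∂(P x) := by
        rw [lintegral_lintegral_swap]
        · refine lintegral_congr fun ω => ?_
          have hω : Measurable fun ℓ : ℝ => (ℓ, ω) := by fun_prop
          exact lintegral_const_mul (W ω) (hinner.comp hω)
        · exact ((hW.comp measurable_snd).mul hinner).aemeasurable
    _ ≤ ∫⁻ ω in {ω | ω.1 u = a.1}, W ω * greenE Λ Z P 0 a b ∂(P x) := by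
        refine lintegral_mono fun ω => ?_
        gcongr
        exact (lintegral_mono_set Ioi_subset_Ici_self).trans (hG (T ω) (hT0 ω) a b)
    _ = (∫⁻ ω, W ω ∂(P x)) * greenE Λ Z P 0 a b := by
        rw [← hrestr, lintegral_mul_const _ hW]

/-- The last step of the walk, of which the time is integrated over. -/
lemma lintegral_walkWeight_succ_le {J : Zd d → ℝ} (hJ : IsJumpFunction J)
    {P : Zd d → Measure (PathSpace d)} (hP : IsWalkLaw J P) {Λ : Finset (Zd d)}
    {Z : (Λ → ℝ) → ℝ} (hZ : Measurable Z)
    (hG : ∀ t ∈ orthant Λ, ∀ a b : Λ, greenE Λ Z P t a b ≤ greenE Λ Z P 0 a b)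
    {β : ℕ → ℕ} (z : ℕ → Λ) (x : Zd d) {n : ℕ} {t : ℕ → ℝ} (h0 : 0 ≤ t n)
    (hβn : t (β n) ≤ t n) (htn : ∀ k ≤ n, t k ≤ t n) :
    ∫⁻ s in Ioi (t n), ∫⁻ ω, walkWeight Λ Z β z t n ω *
        stepWeight Λ Z (z (n + 1)) (t (β n)) (t n) s ω ∂(P x) ≤
      (∫⁻ ω, walkWeight Λ Z β z t n ω ∂(P x)) * greenE Λ Z P 0 (z n) (z (n + 1)) := by
  set u : ℝ≥0 := (t n).toNNReal
  have hu : (u : ℝ) = t n := Real.coe_toNNReal _ h0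
  have hstep : ∀ ℓ, 0 ≤ ℓ → ∀ ω, walkWeight Λ Z β z t n ω *
      stepWeight Λ Z (z (n + 1)) (t (β n)) (t n) (t n + ℓ) ω = walkWeight Λ Z β z t n ω *
        greenIntegrand Λ Z (z (n + 1)) (localTime Λ ω (Icc (t (β n)) (t n))) ℓ
          (shiftPath u ω) := by
    intro ℓ hℓ ω
    by_cases hk : killed Λ ω (t n) = some (z n).1
    · have hk' : killed Λ ω u = some (z n).1 := hu ▸ hk
      congr 1
      have h1 := localTime_shiftPath hk' hℓ
      have h2 := killed_shiftPath hk' hℓ (z (n + 1)).1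
      rw [hu] at h1 h2
      simp only [stepWeight, greenIntegrand, indicator, mem_ofPred_eq, h1, h2]
      rw [← localTime_add ω hβn (by linarith)]
    · simp only [walkWeight_eq_zero hk, zero_mul]
  rw [← (measurePreserving_add_left (volume : Measure ℝ) (t n)).setLIntegral_comp_preimage_emb
    (measurableEmbedding_addLeft (t n))]
  simp only [preimage_const_add_Ioi, sub_self]
  refine le_trans (setLIntegral_mono' measurableSet_Ioi fun ℓ hℓ => ?_)
    (lintegral_mul_greenIntegrand_le hJ hP hZ hG x (z n) (z (n + 1)) u
      (W := walkWeight Λ Z β z t n) (T := fun ω => localTime Λ ω (Icc (t (β n)) (t n)))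
      ?_ ?_ (fun ω => localTime_mem_orthant _ _ _) (fun ω => ?_) (fun ω => ?_) fun ω hω => ?_)
  · exact (lintegral_congr (hstep ℓ (le_of_lt hℓ))).le
  · exact measurable_walkWeight (t := fun _ => t) hZ β z (fun _ => measurable_const)
      measurable_id n
  · exact measurable_localTime_comp measurable_const measurable_const measurable_id
  · exact walkWeight_stopPath (fun k hk => hu ▸ htn k hk) ω
  · exact localTime_stopPath ω hu.ge
  · exact walkWeight_eq_zero fun hk => hω (killed_eq_some_iff.1 hk).2

/-! ### Integration over ordered times -/

/-- Vectors of `n` ordered positive times. -/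
def orderedTimes (n : ℕ) : Set (Fin n → ℝ) := {r | (∀ k, 0 < r k) ∧ StrictMono r}

/-- The `k`-th time, `0 ≤ k ≤ n`, in the list that starts with the time `0`. -/
noncomputable def timeAt (n : ℕ) (r : Fin n → ℝ) (k : ℕ) : ℝ :=
  if h : 1 ≤ k ∧ k ≤ n then r ⟨k - 1, by omega⟩ else 0

lemma timeAt_zero (n : ℕ) (r : Fin n → ℝ) : timeAt n r 0 = 0 := by simp [timeAt]

lemma timeAt_succ {n k : ℕ} (r : Fin n → ℝ) (h : k < n) : timeAt n r (k + 1) = r ⟨k, h⟩ := by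
  have : k + 1 ≤ n := h
  simp [timeAt, this]

lemma measurable_timeAt (n k : ℕ) : Measurable fun r : Fin n → ℝ => timeAt n r k := by
  unfold timeAt
  split_ifs
  · exact measurable_pi_apply _
  · exact measurable_const

lemma timeAt_lt_succ {n k : ℕ} {r : Fin n → ℝ} (hr : r ∈ orderedTimes n) (h : k < n) :
    timeAt n r k < timeAt n r (k + 1) := by
  cases k with
  | zero => rw [timeAt_zero, timeAt_succ r h]; exact hr.1 _
  | succ k =>
    rw [timeAt_succ r h, timeAt_succ r (by omega)]
    exact hr.2 (by simp [Fin.lt_def])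

lemma timeAt_lt_timeAt {n j k : ℕ} {r : Fin n → ℝ} (hr : r ∈ orderedTimes n) (hjk : j < k)
    (h : k ≤ n) : timeAt n r j < timeAt n r k := by
  induction k, hjk using Nat.le_induction with
  | base => exact timeAt_lt_succ hr h
  | succ k hk ih => exact (ih (by omega)).trans (timeAt_lt_succ hr h)

lemma timeAt_le_timeAt {n j k : ℕ} {r : Fin n → ℝ} (hr : r ∈ orderedTimes n) (hjk : j ≤ k)
    (h : k ≤ n) : timeAt n r j ≤ timeAt n r k := by
  rcases hjk.eq_or_lt with rfl | hjk
  · exact le_rfl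
  · exact (timeAt_lt_timeAt hr hjk h).le

lemma timeAt_nonneg {n k : ℕ} {r : Fin n → ℝ} (hr : r ∈ orderedTimes n) (h : k ≤ n) :
    0 ≤ timeAt n r k := timeAt_zero n r ▸ timeAt_le_timeAt hr k.zero_le h

lemma measurableSet_orderedTimes (n : ℕ) : MeasurableSet (orderedTimes n) := by
  have : orderedTimes n = (⋂ k, {r : Fin n → ℝ | 0 < r k}) ∩
      ⋂ i, ⋂ j, ⋂ _ : i < j, {r : Fin n → ℝ | r i < r j} := by
    ext r; simp [orderedTimes, StrictMono]
  rw [this]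
  refine (MeasurableSet.iInter fun k => ?_).inter
    (MeasurableSet.iInter fun i => MeasurableSet.iInter fun j => MeasurableSet.iInter fun _ => ?_)
  · exact measurableSet_lt measurable_const (measurable_pi_apply k)
  · exact measurableSet_lt (measurable_pi_apply i) (measurable_pi_apply j)

lemma timeAt_snoc_of_le {n k : ℕ} (r : Fin n → ℝ) (s : ℝ) (h : k ≤ n) :
    timeAt (n + 1) (Fin.snoc r s : Fin (n + 1) → ℝ) k = timeAt n r k := by
  cases k with
  | zero => simp only [timeAt_zero]
  | succ k =>
    rw [timeAt_succ r h, timeAt_succ _ (by omega)]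
    have : (⟨k, by omega⟩ : Fin (n + 1)) = Fin.castSucc ⟨k, h⟩ := rfl
    rw [this, Fin.snoc_castSucc (α := fun _ => ℝ)]

lemma timeAt_snoc_last {n : ℕ} (r : Fin n → ℝ) (s : ℝ) :
    timeAt (n + 1) (Fin.snoc r s : Fin (n + 1) → ℝ) (n + 1) = s := by
  rw [timeAt_succ _ n.lt_succ_self]
  exact Fin.snoc_last (α := fun _ => ℝ) s r

lemma snoc_mem_orderedTimes {n : ℕ} {r : Fin n → ℝ} {s : ℝ}
    (h : (Fin.snoc r s : Fin (n + 1) → ℝ) ∈ orderedTimes (n + 1)) :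
    r ∈ orderedTimes n ∧ timeAt n r n < s := by
  refine ⟨⟨fun k => ?_, fun i j hij => ?_⟩, ?_⟩
  · simpa using h.1 k.castSucc
  · simpa using h.2 (Fin.castSucc_lt_castSucc_iff.2 hij)
  · rw [← timeAt_snoc_of_le r s le_rfl]
    conv_rhs => rw [← timeAt_snoc_last r s]
    exact timeAt_lt_succ h n.lt_succ_self

lemma lintegral_fin_snoc {n : ℕ} {f : (Fin (n + 1) → ℝ) → ℝ≥0∞} (hf : Measurable f) :
    ∫⁻ r, f r = ∫⁻ r : Fin n → ℝ, ∫⁻ s, f (Fin.snoc r s : Fin (n + 1) → ℝ) := by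
  have hmp := (volume_preserving_piFinSuccAbove (fun _ : Fin (n + 1) => ℝ) (Fin.last n)).symm
  rw [← hmp.lintegral_comp hf, Measure.volume_eq_prod, lintegral_prod_symm]
  · simp only [MeasurableEquiv.piFinSuccAbove_symm_apply]
    refine lintegral_congr fun r => lintegral_congr fun s => ?_
    rw [Fin.insertNthEquiv_last]
    rfl
  · exact (hf.comp hmp.measurable).aemeasurable

/-- Iteration of the Markov property: each step of the walk contributes a Green's function. -/
theorem lintegral_walkWeight_le {J : Zd d → ℝ} (hJ : IsJumpFunction J)
    {P : Zd d → Measure (PathSpace d)} (hP : IsWalkLaw J P) {Λ : Finset (Zd d)}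
    {Z : (Λ → ℝ) → ℝ} (hZ : Measurable Z)
    (hG : ∀ t ∈ orthant Λ, ∀ a b : Λ, greenE Λ Z P t a b ≤ greenE Λ Z P 0 a b)
    {β : ℕ → ℕ} (hβ : ∀ k, β k ≤ k) (z : ℕ → Λ) (x : Zd d) (n : ℕ) :
    ∫⁻ r in orderedTimes n, ∫⁻ ω, walkWeight Λ Z β z (timeAt n r) n ω ∂(P x) ≤
      ∏ k ∈ Finset.range n, greenE Λ Z P 0 (z k) (z (k + 1)) := by
  have := hP.prob
  have hm : ∀ n, Measurable fun r : Fin n → ℝ =>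
      ∫⁻ ω, walkWeight Λ Z β z (timeAt n r) n ω ∂(P x) := fun n =>
    Measurable.lintegral_prod_right' (f := fun q : (Fin n → ℝ) × PathSpace d =>
      walkWeight Λ Z β z (timeAt n q.1) n q.2)
      (measurable_walkWeight hZ β z (fun k => (measurable_timeAt n k).comp measurable_fst)
        measurable_snd n)
  induction n with
  | zero =>
    calc ∫⁻ r in orderedTimes 0, ∫⁻ ω, walkWeight Λ Z β z (timeAt 0 r) 0 ω ∂(P x)
        ≤ ∫⁻ _ in (univ : Set (Fin 0 → ℝ)), ∫⁻ _, 1 ∂(P x) := by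
          refine (lintegral_mono_set (subset_univ _)).trans (lintegral_mono fun r => ?_)
          refine lintegral_mono fun ω => ?_
          simp only [walkWeight, Finset.range_zero, Finset.prod_empty, mul_one]
          exact indicator_le_self' (fun _ _ => zero_le) _
      _ ≤ _ := by simp [volume_pi]
  | succ n ih =>
    have hmem := measurableSet_orderedTimes (n + 1)
    calc ∫⁻ r in orderedTimes (n + 1), ∫⁻ ω, walkWeight Λ Z β z (timeAt (n + 1) r) (n + 1) ω ∂(P x)
        = ∫⁻ r : Fin n → ℝ, ∫⁻ s, (orderedTimes (n + 1)).indicator (fun r =>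
            ∫⁻ ω, walkWeight Λ Z β z (timeAt (n + 1) r) (n + 1) ω ∂(P x))
              (Fin.snoc r s : Fin (n + 1) → ℝ) := by
          rw [← lintegral_indicator hmem, lintegral_fin_snoc ((hm (n + 1)).indicator hmem)]
      _ ≤ ∫⁻ r in orderedTimes n, ∫⁻ s in Ioi (timeAt n r n), ∫⁻ ω,
            walkWeight Λ Z β z (timeAt n r) n ω * stepWeight Λ Z (z (n + 1)) (timeAt n r (β n))
              (timeAt n r n) s ω ∂(P x) := by
          rw [← lintegral_indicator (measurableSet_orderedTimes n)]
          refine lintegral_mono fun r => ?_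
          by_cases hr : r ∈ orderedTimes n
          · rw [indicator_of_mem hr, ← lintegral_indicator measurableSet_Ioi]
            refine lintegral_mono fun s => ?_
            by_cases hs : (Fin.snoc r s : Fin (n + 1) → ℝ) ∈ orderedTimes (n + 1)
            · rw [indicator_of_mem hs, indicator_of_mem (mem_Ioi.2 (snoc_mem_orderedTimes hs).2)]
              refine lintegral_mono fun ω => ?_
              rw [walkWeight_succ, timeAt_snoc_last, timeAt_snoc_of_le r s le_rfl,
                timeAt_snoc_of_le r s (hβ n),
                walkWeight_congr hβ (fun k hk => timeAt_snoc_of_le r s hk)]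
            · rw [indicator_of_notMem hs]
              exact zero_le
          · rw [indicator_of_notMem hr]
            refine (lintegral_eq_zero_of_ae_eq_zero (.of_forall fun s => ?_)).le
            exact indicator_of_notMem (fun hs => hr (snoc_mem_orderedTimes hs).1) _
      _ ≤ ∫⁻ r in orderedTimes n, (∫⁻ ω, walkWeight Λ Z β z (timeAt n r) n ω ∂(P x)) *
            greenE Λ Z P 0 (z n) (z (n + 1)) := by
          refine setLIntegral_mono' (measurableSet_orderedTimes n) fun r hr => ?_
          exact lintegral_walkWeight_succ_le hJ hP hZ hG z x (timeAt_nonneg hr le_rfl)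
            (timeAt_le_timeAt hr (hβ n) le_rfl) fun k hk => timeAt_le_timeAt hr hk le_rfl
      _ = (∫⁻ r in orderedTimes n, ∫⁻ ω, walkWeight Λ Z β z (timeAt n r) n ω ∂(P x)) *
            greenE Λ Z P 0 (z n) (z (n + 1)) := lintegral_mul_const _ (hm n)
      _ ≤ _ := by
          rw [Finset.prod_range_succ]
          gcongr

/-! ### Partial derivatives on the orthant -/

section Orthant

variable {Λ : Finset (Zd d)}

lemma convex_orthant : Convex ℝ (orthant Λ) := by
  intro s hs t ht a b ha hb _ x
  exact add_nonneg (mul_nonneg ha (hs x)) (mul_nonneg hb (ht x))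

lemma uniqueDiffOn_orthant : UniqueDiffOn ℝ (orthant Λ) := by
  refine uniqueDiffOn_convex convex_orthant ⟨fun _ => 1, ?_⟩
  rw [mem_interior]
  refine ⟨{t | ∀ x, 0 < t x}, fun t ht x => (ht x).le, ?_, fun _ => one_pos⟩
  have : {t : Λ → ℝ | ∀ x, 0 < t x} = ⋂ x, {t | 0 < t x} := by ext; simp
  rw [this]
  exact isOpen_iInter_of_finite fun x => isOpen_lt continuous_const (continuous_apply x)

lemma partialDeriv_eq_fderivWithin {f : (Λ → ℝ) → ℝ} {t : Λ → ℝ} (ht : t ∈ orthant Λ)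
    (hf : DifferentiableWithinAt ℝ f (orthant Λ) t) (x : Λ) :
    partialDeriv Λ x f t = fderivWithin ℝ f (orthant Λ) t (Pi.single x 1) := by
  have h : UniqueDiffWithinAt ℝ
      ((fun r : ℝ => t + r • (Pi.single x 1 : Λ → ℝ)) ⁻¹' orthant Λ) 0 := by
    refine (uniqueDiffOn_Ici (0 : ℝ) 0 self_mem_Ici).mono fun r hr y => ?_
    have h1 : (0 : Λ → ℝ) ≤ Pi.single x 1 := Pi.single_nonneg.2 zero_le_one
    exact add_nonneg (ht y) (mul_nonneg hr (h1 y))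
  exact HasDerivWithinAt.derivWithin (hf.hasFDerivWithinAt.hasLineDerivWithinAt _) h

lemma contDiffOn_partialDeriv {f : (Λ → ℝ) → ℝ} {n : ℕ} (hf : ContDiffOn ℝ (n + 1) f (orthant Λ))
    (x : Λ) : ContDiffOn ℝ n (partialDeriv Λ x f) (orthant Λ) := by
  refine ((hf.fderivWithin uniqueDiffOn_orthant le_rfl).clm_apply
    (contDiffOn_const (c := (Pi.single x 1 : Λ → ℝ)))).congr fun t ht => ?_
  exact partialDeriv_eq_fderivWithin ht (hf.differentiableOn (by simp) t ht) x

/-- The chain rule for a curve in the orthant whose velocity is a multiple of a basis vector. -/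
lemma hasDerivWithinAt_comp_orthant {f : (Λ → ℝ) → ℝ} {γ : ℝ → Λ → ℝ} {S : Set ℝ} {r c : ℝ} {x : Λ}
    (hS : MapsTo γ S (orthant Λ)) (hr : γ r ∈ orthant Λ)
    (hf : DifferentiableWithinAt ℝ f (orthant Λ) (γ r))
    (hγ : HasDerivWithinAt γ (c • (Pi.single x 1 : Λ → ℝ)) S r) :
    HasDerivWithinAt (fun r => f (γ r)) (c * partialDeriv Λ x f (γ r)) S r := by
  have := hf.hasFDerivWithinAt.comp_hasDerivWithinAt r hγ hS
  rwa [map_smul, ← partialDeriv_eq_fderivWithin hr hf, smul_eq_mul] at this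

end Orthant

/-! ### The vertex function away from the jumps -/

section Vertex

variable {Λ : Finset (Zd d)} {ω : PathSpace d}

lemma hasDerivAt_localTime_right {s t : ℝ} {b : Λ} (hst : s < t)
    (hb : ∀ᶠ u in 𝓝 t, killed Λ ω u = some b.1) :
    HasDerivAt (fun t' => localTime Λ ω (Icc s t')) (Pi.single b 1 : Λ → ℝ) t := by
  obtain ⟨ε, hε, h⟩ := Metric.eventually_nhds_iff.1 hb
  have haff : HasDerivAt (fun t' => localTime Λ ω (Icc s t) + (t' - t) • (Pi.single b 1 : Λ → ℝ))
      (Pi.single b 1 : Λ → ℝ) t := by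
    simpa using (((hasDerivAt_id t).sub_const t).smul_const
      (Pi.single b 1 : Λ → ℝ)).const_add (localTime Λ ω (Icc s t))
  refine haff.congr_of_eventuallyEq ?_
  filter_upwards [lt_mem_nhds hst, Metric.ball_mem_nhds t hε] with t' hst' ht'
  rw [Metric.mem_ball, Real.dist_eq, abs_lt] at ht'
  rcases le_total t t' with hle | hle
  · rw [localTime_add ω hst.le hle, localTime_of_const hle (a := b)]
    intro u h1 h2
    exact h (by rw [Real.dist_eq, abs_lt]; constructor <;> linarith)
  · rw [localTime_add ω hst'.le hle, localTime_of_const hle (a := b), add_assoc, ← add_smul]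
    · simp
    · intro u h1 h2
      exact h (by rw [Real.dist_eq, abs_lt]; constructor <;> linarith)

lemma hasDerivWithinAt_localTime_left {s t : ℝ} {a : Λ} (hst : s < t)
    (ha : ∀ᶠ u in 𝓝[Ici 0] s, killed Λ ω u = some a.1) (hs0 : 0 ≤ s) :
    HasDerivWithinAt (fun s' => localTime Λ ω (Icc s' t)) ((-1 : ℝ) • (Pi.single a 1 : Λ → ℝ))
      (Icc 0 t) s := by
  obtain ⟨ε, hε, h⟩ := Metric.eventually_nhds_iff.1 (eventually_nhdsWithin_iff.1 ha)
  have haff : HasDerivAt (fun s' => localTime Λ ω (Icc s t) + (s - s') • (Pi.single a 1 : Λ → ℝ))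
      ((-1 : ℝ) • (Pi.single a 1 : Λ → ℝ)) s :=
    (((hasDerivAt_id s).const_sub s).smul_const
      (Pi.single a 1 : Λ → ℝ)).const_add (localTime Λ ω (Icc s t))
  refine haff.hasDerivWithinAt.congr_of_eventuallyEq ?_ (by simp)
  filter_upwards [nhdsWithin_le_nhds (gt_mem_nhds hst),
    nhdsWithin_le_nhds (Metric.ball_mem_nhds s hε), self_mem_nhdsWithin] with s' hst' hs' h0
  rw [Metric.mem_ball, Real.dist_eq, abs_lt] at hs'
  rcases le_total s' s with hle | hle
  · rw [localTime_add ω hle hst.le, localTime_of_const hle (a := a), add_comm]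
    intro u h1 h2
    exact h (by rw [Real.dist_eq, abs_lt]; constructor <;> linarith) (h0.1.trans h1.le)
  · rw [localTime_add ω hle hst'.le, localTime_of_const hle (a := a), add_right_comm, ← add_smul]
    · simp
    · intro u h1 h2
      exact h (by rw [Real.dist_eq, abs_lt]; constructor <;> linarith) (hs0.trans h1.le)

/-- If the walk does not jump at the times `s` and `t`, the vertex function `r_{s,t}` is
`r_{s,t}(X_s, X_t)`, because the derivative of the local time is the indicator of the position. -/
theorem vertex_eq_vertexAt {Z : (Λ → ℝ) → ℝ} (hZpos : ∀ t ∈ orthant Λ, 0 < Z t)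
    (hZ2 : ContDiffOn ℝ 2 Z (orthant Λ)) {s t : ℝ} {a b : Λ} (hs0 : 0 ≤ s) (hst : s < t)
    (ha : ∀ᶠ u in 𝓝[Ici 0] s, killed Λ ω u = some a.1)
    (hb : ∀ᶠ u in 𝓝 t, killed Λ ω u = some b.1) :
    vertex Λ Z ω s t = vertexAt Λ Z ω s t a b := by
  have hf : ContDiffOn ℝ ((1 : ℕ) + 1) (fun v => Real.log (Z v)) (orthant Λ) :=
    (hZ2.log fun v hv => (hZpos v hv).ne').of_le (by norm_num)
  have hφ := contDiffOn_partialDeriv hf b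
  have hmem : ∀ I, localTime Λ ω I ∈ orthant Λ := localTime_mem_orthant Λ ω
  have hinner : ∀ s', s' < t →
      derivWithin (fun t' => Real.log (Yfun Λ Z ω s' t')) (Ici s') t =
        partialDeriv Λ b (fun v => Real.log (Z v)) (localTime Λ ω (Icc s' t)) := by
    intro s' hs't
    have hlog : (fun t' => Real.log (Yfun Λ Z ω s' t')) =
        fun t' => Real.log (Z (localTime Λ ω (Icc s' t'))) - Real.log (Z 0) := by
      ext t'
      exact Real.log_div (hZpos _ (hmem _)).ne' (hZpos 0 fun _ => le_rfl).ne'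
    rw [hlog]
    have := hasDerivWithinAt_comp_orthant (c := 1) (fun r (_ : r ∈ Ici s') => hmem (Icc s' r))
      (hmem (Icc s' t)) (hf.differentiableOn (by simp) _ (hmem _))
      (by simpa using (hasDerivAt_localTime_right hs't hb).hasDerivWithinAt)
    rw [one_mul] at this
    exact (this.sub_const _).derivWithin (uniqueDiffOn_Ici s' t hs't.le)
  have houter := hasDerivWithinAt_comp_orthant (fun r (_ : r ∈ Icc 0 t) => hmem (Icc r t))
    (hmem (Icc s t)) (hφ.differentiableOn (by simp) _ (hmem _))
    (hasDerivWithinAt_localTime_left hst ha hs0)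
  have hcongr : (fun s' => derivWithin (fun t' => Real.log (Yfun Λ Z ω s' t')) (Ici s') t)
      =ᶠ[𝓝[Icc 0 t] s]
      fun s' => partialDeriv Λ b (fun v => Real.log (Z v)) (localTime Λ ω (Icc s' t)) := by
    filter_upwards [nhdsWithin_le_nhds (gt_mem_nhds hst)] with s' hs'
    exact hinner s' hs'
  have hd := (houter.congr_of_eventuallyEq hcongr (hinner s hst)).derivWithin
    (uniqueDiffOn_Icc (hs0.trans_lt hst) s ⟨hs0, hst.le⟩)
  rw [vertex, hd, vertexAt]
  ring

/-! ### Jump times form a null set -/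

lemma killed_eq_some_of_const {t u : ℝ} {b : Zd d} (h : killed Λ ω t = some b)
    (hc : ∀ v ∈ uIcc t u, ω.1 v.toNNReal = ω.1 t.toNNReal) : killed Λ ω u = some b := by
  rw [killed_eq_some_iff] at h ⊢
  refine ⟨fun s hs => ?_, (hc u right_mem_uIcc).trans h.2⟩
  rcases le_or_gt s t.toNNReal with hst | hst
  · exact h.1 s hst
  · have h1 : t < s := (Real.le_coe_toNNReal t).trans_lt (by exact_mod_cast hst)
    have hs0 : 0 < s := zero_le.trans_lt hst
    have h2 : (s : ℝ) ≤ u := (Real.le_toNNReal_iff_coe_le' hs0).1 hs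
    have := hc s (mem_uIcc.2 (.inl ⟨h1.le, h2⟩))
    rw [Real.toNNReal_coe] at this
    rw [this]
    exact h.1 _ le_rfl

/-- The pairs of a time and a path, such that the path does not jump at that time. Quantification
over rational times makes the set measurable. -/
def noJump (d : ℕ) : Set (ℝ × PathSpace d) :=
  {p | ∃ n : ℕ, ∀ q q' : ℚ, |(q : ℝ) - p.1| < 1 / ((n : ℝ) + 1) →
    |(q' : ℝ) - p.1| < 1 / ((n : ℝ) + 1) → p.2.1 (q : ℝ).toNNReal = p.2.1 (q' : ℝ).toNNReal}

lemma measurableSet_noJump : MeasurableSet (noJump d) := by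
  have h : noJump d = ⋃ n : ℕ, ⋂ q : ℚ, ⋂ q' : ℚ,
      ({p : ℝ × PathSpace d | |(q : ℝ) - p.1| < 1 / ((n : ℝ) + 1)}ᶜ ∪
        ({p : ℝ × PathSpace d | |(q' : ℝ) - p.1| < 1 / ((n : ℝ) + 1)}ᶜ ∪
          {p : ℝ × PathSpace d | p.2.1 (q : ℝ).toNNReal = p.2.1 (q' : ℝ).toNNReal})) := by
    ext p
    simp only [noJump, mem_ofPred_eq, mem_iUnion, mem_iInter, mem_union, mem_compl_iff,
      imp_iff_not_or]
  rw [h]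
  refine MeasurableSet.iUnion fun n => MeasurableSet.iInter fun q => MeasurableSet.iInter fun q' =>
    ?_
  have hm : ∀ q : ℚ, MeasurableSet {p : ℝ × PathSpace d | |(q : ℝ) - p.1| < 1 / ((n : ℝ) + 1)} :=
    fun q => measurableSet_lt (by fun_prop) measurable_const
  exact (hm q).compl.union ((hm q').compl.union (measurableSet_eq_fun
    ((measurable_coord _).comp measurable_snd) ((measurable_coord _).comp measurable_snd)))

lemma eventually_right_eq_real (ω : PathSpace d) (t : ℝ) :
    ∀ᶠ u in 𝓝[≥] t, ω.1 u.toNNReal = ω.1 t.toNNReal := by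
  have : Tendsto Real.toNNReal (𝓝[≥] t) (𝓝[≥] t.toNNReal) :=
    tendsto_nhdsWithin_iff.2 ⟨(continuous_real_toNNReal.tendsto t).mono_left nhdsWithin_le_nhds,
      by filter_upwards [self_mem_nhdsWithin] with u hu using Real.toNNReal_le_toNNReal hu⟩
  exact this.eventually (eventually_right_eq ω t.toNNReal)

lemma exists_eventually_left_eq_real (ω : PathSpace d) (t : ℝ) :
    ∃ l, ∀ᶠ u in 𝓝[<] t, ω.1 u.toNNReal = l := by
  rcases le_or_gt t 0 with ht | ht
  · refine ⟨ω.1 0, ?_⟩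
    filter_upwards [self_mem_nhdsWithin] with u hu
    rw [Real.toNNReal_of_nonpos ((mem_Iio.1 hu).le.trans ht)]
  · obtain ⟨l, hl⟩ := exists_eventually_left_eq ω t.toNNReal
    have : Tendsto Real.toNNReal (𝓝[<] t) (𝓝[<] t.toNNReal) :=
      tendsto_nhdsWithin_iff.2 ⟨(continuous_real_toNNReal.tendsto t).mono_left nhdsWithin_le_nhds,
        by filter_upwards [self_mem_nhdsWithin] with u hu
           exact (Real.toNNReal_lt_toNNReal_iff ht).2 hu⟩
    exact ⟨l, this.eventually hl⟩

lemma eventually_eq_of_noJump {t : ℝ} (h : (t, ω) ∈ noJump d) :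
    ∃ ε > 0, ∀ u, |u - t| < ε → ω.1 u.toNNReal = ω.1 t.toNNReal := by
  obtain ⟨n, hn⟩ := h
  refine ⟨1 / ((n : ℝ) + 1), by positivity, ?_⟩
  -- every value is the value at a rational time a little later
  have hrat : ∀ u : ℝ, |u - t| < 1 / ((n : ℝ) + 1) → ∃ q : ℚ, |(q : ℝ) - t| < 1 / ((n : ℝ) + 1) ∧
      ω.1 (q : ℝ).toNNReal = ω.1 u.toNNReal := by
    intro u hu
    have hu' : u < t + 1 / ((n : ℝ) + 1) := by linarith [(abs_lt.1 hu).2]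
    obtain ⟨v, hv, hvc⟩ := (mem_nhdsGE_iff_exists_Ico_subset' hu').1 (eventually_right_eq_real ω u)
    obtain ⟨q, hq1, hq2⟩ := exists_rat_btwn (lt_min hv hu')
    refine ⟨q, ?_, hvc ⟨hq1.le, hq2.trans_le (min_le_left _ _)⟩⟩
    rw [abs_lt] at hu ⊢
    have := hq2.trans_le (min_le_right _ _)
    constructor <;> linarith
  intro u hu
  obtain ⟨q, hq, e⟩ := hrat u hu
  obtain ⟨q', hq', e'⟩ := hrat t (by simp; positivity)
  rw [← e, ← e']
  exact hn q q' hq hq'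

lemma noJump_of_const {t ε : ℝ} (hε : 0 < ε)
    (h : ∀ u, |u - t| < ε → ω.1 u.toNNReal = ω.1 t.toNNReal) : (t, ω) ∈ noJump d := by
  obtain ⟨n, hn⟩ := exists_nat_one_div_lt hε
  exact ⟨n, fun q q' hq hq' => (h q (hq.trans hn)).trans (h q' (hq'.trans hn)).symm⟩

/-- Almost no time is a jump time. -/
lemma ae_noJump (ω : PathSpace d) : ∀ᵐ t : ℝ, (t, ω) ∈ noJump d := by
  refine measure_null_of_locally_null _ fun t _ => ⟨{t}, ?_, by simp⟩
  obtain ⟨l, hl⟩ := exists_eventually_left_eq_real ω t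
  obtain ⟨a, ha, hac⟩ := (mem_nhdsLT_iff_exists_Ioo_subset' (sub_one_lt t)).1 hl
  obtain ⟨b, hb, hbc⟩ := (mem_nhdsGE_iff_exists_Ico_subset' (lt_add_one t)).1
    (eventually_right_eq_real ω t)
  rw [mem_nhdsWithin_iff_eventually]
  filter_upwards [Ioo_mem_nhds ha hb] with s hs hmem
  by_contra hne
  refine hmem ?_
  rcases lt_or_gt_of_ne hne with h | h
  · refine noJump_of_const (ε := min (s - a) (t - s)) (by simp [hs.1, h]) fun u hu => ?_
    rw [lt_min_iff, abs_lt, abs_lt] at hu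
    have h1 := hac (show u ∈ Ioo a t from ⟨by linarith, by linarith⟩)
    have h2 := hac (show s ∈ Ioo a t from ⟨hs.1, h⟩)
    exact h1.trans h2.symm
  · refine noJump_of_const (ε := min (s - t) (b - s)) (by simp [hs.2, h]) fun u hu => ?_
    rw [lt_min_iff, abs_lt, abs_lt] at hu
    have h1 := hbc (show u ∈ Ico t b from ⟨by linarith, by linarith⟩)
    have h2 := hbc (show s ∈ Ico t b from ⟨le_of_lt h, hs.2⟩)
    exact h1.trans h2.symm

lemma eventually_killed_of_noJump {t : ℝ} {b : Zd d} (h : (t, ω) ∈ noJump d)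
    (hb : killed Λ ω t = some b) : ∀ᶠ u in 𝓝 t, killed Λ ω u = some b := by
  obtain ⟨ε, hε, hc⟩ := eventually_eq_of_noJump h
  filter_upwards [Metric.ball_mem_nhds t hε] with u hu
  refine killed_eq_some_of_const hb fun v hv => hc v ?_
  rw [Metric.mem_ball, Real.dist_eq] at hu
  exact (abs_sub_left_of_mem_uIcc hv).trans_lt hu

lemma eventually_killed_zero {b : Zd d} (hb : killed Λ ω 0 = some b) :
    ∀ᶠ u in 𝓝[Ici 0] 0, killed Λ ω u = some b := by
  obtain ⟨v, hv, hc⟩ := (mem_nhdsGE_iff_exists_Ico_subset' (zero_lt_one' ℝ)).1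
    (eventually_right_eq_real ω 0)
  filter_upwards [Ico_mem_nhdsGE hv] with u hu
  refine killed_eq_some_of_const hb fun w hw => hc ?_
  rw [uIcc_of_le hu.1] at hw
  exact ⟨hw.1, hw.2.trans_lt hu.2⟩

end Vertex

/-! ### Functions of the local time that are continuous on the orthant -/

section Continuous

variable {Λ : Finset (Zd d)}

/-- The coordinatewise positive part, a continuous retraction onto the orthant. -/
noncomputable def toOrthant (Λ : Finset (Zd d)) (t : Λ → ℝ) : Λ → ℝ := fun x => max (t x) 0

lemma toOrthant_mem (t : Λ → ℝ) : toOrthant Λ t ∈ orthant Λ := fun _ => le_max_right _ _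

lemma toOrthant_of_mem {t : Λ → ℝ} (ht : t ∈ orthant Λ) : toOrthant Λ t = t :=
  funext fun x => max_eq_left (ht x)

lemma continuous_comp_toOrthant {F : (Λ → ℝ) → ℝ} (hF : ContinuousOn F (orthant Λ)) :
    Continuous fun t => F (toOrthant Λ t) :=
  hF.comp_continuous (by unfold toOrthant; fun_prop) toOrthant_mem

lemma measurable_comp_localTime {α : Type*} [MeasurableSpace α] {F : (Λ → ℝ) → ℝ}
    (hF : ContinuousOn F (orthant Λ)) {s t : α → ℝ} {p : α → PathSpace d} (hs : Measurable s)
    (ht : Measurable t) (hp : Measurable p) :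
    Measurable fun a => F (localTime Λ (p a) (Icc (s a) (t a))) := by
  have h := (continuous_comp_toOrthant hF).measurable.comp (measurable_localTime_comp hs ht hp)
  simpa only [Function.comp_def, toOrthant_of_mem (localTime_mem_orthant Λ _ _)] using h

lemma greenE_comp_toOrthant (Z : (Λ → ℝ) → ℝ) (P : Zd d → Measure (PathSpace d)) {t : Λ → ℝ}
    (ht : t ∈ orthant Λ) (a b : Λ) :
    greenE Λ (fun t => Z (toOrthant Λ t)) P t a b = greenE Λ Z P t a b := by
  unfold greenE
  have h : ∀ ω : PathSpace d, ∀ I, t + localTime Λ ω I ∈ orthant Λ := fun ω I x =>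
    add_nonneg (ht x) (localTime_mem_orthant Λ ω I x)
  simp only [toOrthant_of_mem ht, toOrthant_of_mem (h _ _)]

lemma walkWeight_comp_toOrthant (Z : (Λ → ℝ) → ℝ) (β : ℕ → ℕ) (z : ℕ → Λ) (t : ℕ → ℝ) (n : ℕ)
    (ω : PathSpace d) :
    walkWeight Λ (fun t => Z (toOrthant Λ t)) β z t n ω = walkWeight Λ Z β z t n ω := by
  simp only [walkWeight, stepWeight, toOrthant_of_mem (localTime_mem_orthant Λ _ _)]

end Continuous

/-! ### Laces as ordered times -/

section Laces

variable {Λ : Finset (Zd d)}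

lemma laceS_eq_timeAt (m : ℕ) (r : Fin (2 * m - 1) → ℝ) (i : ℕ) :
    laceS m r i = timeAt (2 * m - 1) r (2 * i - 1) := by
  rcases i.eq_zero_or_pos with rfl | hi
  · simp [laceS, timeAt_zero]
  · rw [laceS, if_neg hi.ne']
    rfl

lemma laceS'_eq_timeAt {m : ℕ} (r : Fin (2 * m - 1) → ℝ) {i : ℕ} (hi : i ≤ m) :
    laceS' m r i = timeAt (2 * m - 1) r (min (2 * i) (2 * m - 1)) := by
  rcases hi.eq_or_lt with rfl | hi
  · rw [laceS', if_pos rfl, laceS_eq_timeAt, min_eq_right (by omega)]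
  · rw [laceS', if_neg hi.ne, min_eq_left (by omega)]
    rfl

lemma prod_range_two_mul {M : Type*} [CommMonoid M] (f : ℕ → M) (n : ℕ) :
    ∏ k ∈ Finset.range (2 * n), f k = ∏ i ∈ Finset.range n, f (2 * i) * f (2 * i + 1) := by
  induction n with
  | zero => simp
  | succ n ih => rw [Finset.prod_range_succ, ← ih, mul_add, mul_one, Finset.prod_range_succ,
      Finset.prod_range_succ, mul_assoc]

/-- The base point for the step `k` of a lace: local time is collected since the time `s'_{j-1}`
in the steps from `s'_j` to `s_{j+1}` and from `s_{j+1}` to `s'_{j+1}`. For `j = 0` the truncated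
subtraction makes it the time `0`. -/
def laceBase (k : ℕ) : ℕ := 2 * (k / 2 - 1)

lemma laceBase_le (k : ℕ) : laceBase k ≤ k := by unfold laceBase; omega

/-- The factor `P(L)` telescopes into ratios, one for each of the `2 m - 1` steps. -/
lemma laceP_eq_prod {Z : (Λ → ℝ) → ℝ} (hZpos : ∀ t ∈ orthant Λ, 0 < Z t) {m : ℕ} (hm : 1 ≤ m)
    (r : Fin (2 * m - 1) → ℝ) (ω : PathSpace d) :
    laceP Λ Z m r ω = ∏ k ∈ Finset.range (2 * m - 1),
      Z (localTime Λ ω (Icc (timeAt (2 * m - 1) r (laceBase k)) (timeAt (2 * m - 1) r (k + 1)))) /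
        Z (localTime Λ ω (Icc (timeAt (2 * m - 1) r (laceBase k)) (timeAt (2 * m - 1) r k))) := by
  have hne : ∀ I, Z (localTime Λ ω I) ≠ 0 := fun I => (hZpos _ (localTime_mem_orthant Λ ω I)).ne'
  have hZ0 : Z 0 ≠ 0 := (hZpos 0 fun _ => le_rfl).ne'
  obtain ⟨n, rfl⟩ := Nat.exists_eq_add_of_le' hm
  let N := 2 * (n + 1) - 1
  have hN : N = 2 * (n + 1) - 1 := rfl
  let T := timeAt N r
  -- the list of times is extended by repetition of the last time, with a trivial last ratio
  let T' : ℕ → ℝ := fun k => T (min k N)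
  let R : ℕ → ℝ := fun k => Z (localTime Λ ω (Icc (T' (laceBase k)) (T' (k + 1)))) /
    Z (localTime Λ ω (Icc (T' (laceBase k)) (T' k)))
  have hRN : R N = 1 := by
    have h1 : T' (N + 1) = T' N := by simp [T']
    simp only [R, h1]
    exact div_self (hne _)
  have hpair : ∀ i, R (2 * i) * R (2 * i + 1) =
      Z (localTime Λ ω (Icc (T' (2 * (i - 1))) (T' (2 * (i + 1))))) /
        Z (localTime Λ ω (Icc (T' (2 * (i - 1))) (T' (2 * i)))) := by
    intro i
    have h1 : laceBase (2 * i) = 2 * (i - 1) := by unfold laceBase; omega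
    have h2 : laceBase (2 * i + 1) = 2 * (i - 1) := by unfold laceBase; omega
    simp only [R, h1, h2]
    rw [div_mul_div_comm, mul_comm, mul_div_mul_right _ _ (hne _)]
    rfl
  have hS' : ∀ i ≤ n + 1, laceS' (n + 1) r i = T' (2 * i) := fun i hi => laceS'_eq_timeAt r hi
  have hprod : ∏ k ∈ Finset.range N, R k = ∏ k ∈ Finset.range (2 * (n + 1)), R k := by
    have : 2 * (n + 1) = N + 1 := by omega
    rw [this, Finset.prod_range_succ, hRN, mul_one]
  have hR : ∏ k ∈ Finset.range N, Z (localTime Λ ω (Icc (T (laceBase k)) (T (k + 1)))) /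
      Z (localTime Λ ω (Icc (T (laceBase k)) (T k))) = ∏ k ∈ Finset.range N, R k := by
    refine Finset.prod_congr rfl fun k hk => ?_
    have hk := Finset.mem_range.1 hk
    have hb := laceBase_le k
    simp only [R, T', min_eq_left hk.le, min_eq_left (show k + 1 ≤ N from hk),
      min_eq_left (hb.trans hk.le)]
  refine Eq.trans ?_ hR.symm
  rw [hprod, prod_range_two_mul, Finset.prod_range_succ', mul_comm, laceP, Nat.add_sub_cancel]
  congr 1
  · rw [hpair, hS' 0 (by omega), hS' 1 (by omega)]
    simp only [Yfun, mul_zero, zero_tsub, localTime_self, zero_add]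
  · refine Finset.prod_congr rfl fun i hi => ?_
    have hi := Finset.mem_range.1 hi
    rw [hpair, hS' i (by omega), hS' (i + 1) (by omega), hS' (i + 2) (by omega)]
    simp only [Yfun, Nat.add_sub_cancel]
    rw [div_div_div_cancel_right₀ hZ0]

/-- The points that a walk visits at the times `s₀', s₁, s₁', s₂, …, s_m` of a lace, given the
labels of a diagram. -/
def lacePoints {m : ℕ} (v : Fin (m + 1) → Λ × Λ) (k : ℕ) : Λ :=
  if k % 2 = 0 then (v (Fin.ofNat (m + 1) (k / 2))).2 else (v (Fin.ofNat (m + 1) ((k + 1) / 2))).1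

lemma lacePoints_two_mul {m : ℕ} (v : Fin (m + 1) → Λ × Λ) (i : ℕ) :
    lacePoints v (2 * i) = (v (Fin.ofNat (m + 1) i)).2 := by
  rw [lacePoints, if_pos (by omega), Nat.mul_div_cancel_left i two_pos]

lemma lacePoints_two_mul_add_one {m : ℕ} (v : Fin (m + 1) → Λ × Λ) (i : ℕ) :
    lacePoints v (2 * i + 1) = (v (Fin.ofNat (m + 1) (i + 1))).1 := by
  rw [lacePoints, if_neg (by omega)]
  congr 3
  omega

/-- The contribution of a labelled diagram, as a product over the vertices of the lace and a
product over the steps of the walk. -/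
lemma diagram_eq_prod {m : ℕ} (hm : 1 ≤ m) {x y : Λ} {v : Fin (m + 1) → Λ × Λ}
    (hv : v ∈ diagramVertices Λ m x y) (g rbar : Λ → Λ → ℝ) :
    (∏ i ∈ Finset.range m,
        rbar (v (Fin.ofNat (m + 1) i)).1 (v (Fin.ofNat (m + 1) (i + 1))).2) *
      ∏ k ∈ Finset.range (2 * m - 1), g (lacePoints v k) (lacePoints v (k + 1)) =
    g x (v (Fin.ofNat (m + 1) 1)).1 * rbar x (v (Fin.ofNat (m + 1) 1)).2 *
      ∏ j ∈ Finset.Ico 1 m,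
        (g (v (Fin.ofNat (m + 1) j)).1 (v (Fin.ofNat (m + 1) j)).2 *
          g (v (Fin.ofNat (m + 1) j)).2 (v (Fin.ofNat (m + 1) (j + 1))).1 *
          rbar (v (Fin.ofNat (m + 1) j)).1 (v (Fin.ofNat (m + 1) (j + 1))).2) := by
  obtain ⟨n, rfl⟩ := Nat.exists_eq_add_of_le' hm
  have hv0 : v (Fin.ofNat (n + 1 + 1) 0) = (x, x) := (Finset.mem_filter.1 hv).2.1
  have h0 : lacePoints v 0 = x := by
    have := lacePoints_two_mul v 0
    rw [mul_zero, hv0] at this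
    exact this
  have h1 : lacePoints v 1 = (v (Fin.ofNat (n + 1 + 1) 1)).1 := lacePoints_two_mul_add_one v 0
  have hN : 2 * (n + 1) - 1 = 2 * n + 1 := by omega
  rw [hN, Finset.prod_range_succ', Finset.prod_range_succ', hv0, h0, zero_add, h1,
    prod_range_two_mul (fun k => g (lacePoints v (k + 1)) (lacePoints v (k + 1 + 1))),
    Finset.prod_Ico_eq_prod_range, Nat.add_sub_cancel]
  have hterm : ∀ i, g (lacePoints v (2 * i + 1)) (lacePoints v (2 * i + 1 + 1)) *
      g (lacePoints v (2 * i + 1 + 1)) (lacePoints v (2 * i + 1 + 1 + 1)) =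
      g (v (Fin.ofNat (n + 1 + 1) (1 + i))).1 (v (Fin.ofNat (n + 1 + 1) (1 + i))).2 *
        g (v (Fin.ofNat (n + 1 + 1) (1 + i))).2 (v (Fin.ofNat (n + 1 + 1) (1 + i + 1))).1 := by
    intro i
    have e1 := lacePoints_two_mul_add_one v i
    have e2 := lacePoints_two_mul v (i + 1)
    have e3 := lacePoints_two_mul_add_one v (i + 1)
    rw [show 2 * (i + 1) = 2 * i + 1 + 1 by ring] at e2 e3
    rw [e1, e2, e3, add_comm 1 i]
  simp only [hterm, Finset.prod_mul_distrib, add_comm 1]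
  ring

end Laces

/-! ### The bound on the integrand -/

section Bound

variable {Λ : Finset (Zd d)} {Z : (Λ → ℝ) → ℝ}

/-- The vertex function as a measurable function of the times and the path: a sum over the
positions of the walk at the two times. -/
noncomputable def vertexSum (Λ : Finset (Zd d)) (Z : (Λ → ℝ) → ℝ) (ω : PathSpace d) (s t : ℝ) : ℝ :=
  ∑ a : Λ, ∑ b : Λ, ({η | killed Λ η s = some a.1} ∩ {η | killed Λ η t = some b.1} :
    Set (PathSpace d)).indicator (fun η => vertexAt Λ Z η s t a b) ω

lemma vertexSum_eq {ω : PathSpace d} {s t : ℝ} {a b : Λ} (ha : killed Λ ω s = some a.1)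
    (hb : killed Λ ω t = some b.1) : vertexSum Λ Z ω s t = vertexAt Λ Z ω s t a b := by
  unfold vertexSum
  rw [Finset.sum_eq_single a, Finset.sum_eq_single b]
  · exact indicator_of_mem (s := {η | killed Λ η s = some a.1} ∩ {η | killed Λ η t = some b.1})
      ⟨ha, hb⟩ _
  · rintro b' - hb'
    refine indicator_of_notMem (fun h => hb' ?_) _
    exact Subtype.ext (Option.some_inj.1 (h.2.symm.trans hb))
  · simp
  · rintro a' - ha'
    refine Finset.sum_eq_zero fun b' _ => indicator_of_notMem (fun h => ha' ?_) _
    exact Subtype.ext (Option.some_inj.1 (h.1.symm.trans ha))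
  · simp

lemma measurable_vertexSum {α : Type*} [MeasurableSpace α] (hZpos : ∀ t ∈ orthant Λ, 0 < Z t)
    (hZ2 : ContDiffOn ℝ 2 Z (orthant Λ)) {s t : α → ℝ} {p : α → PathSpace d} (hs : Measurable s)
    (ht : Measurable t) (hp : Measurable p) :
    Measurable fun a => vertexSum Λ Z (p a) (s a) (t a) := by
  unfold vertexSum
  refine Finset.measurable_fun_sum _ fun a _ => Finset.measurable_fun_sum _ fun b _ => ?_
  have hf : ContDiffOn ℝ ((1 : ℕ) + 1) (fun v => Real.log (Z v)) (orthant Λ) :=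
    (hZ2.log fun v hv => (hZpos v hv).ne').of_le (by norm_num)
  have hc : ContDiffOn ℝ (0 : ℕ)
      (partialDeriv Λ a (partialDeriv Λ b fun v => Real.log (Z v))) (orthant Λ) :=
    contDiffOn_partialDeriv (n := 0) ((contDiffOn_partialDeriv hf b).of_le (by simp)) a
  have hm := measurable_comp_localTime hc.continuousOn hs ht hp
  exact hm.indicator
    ((measurableSet_killed_comp hs hp a.1).inter (measurableSet_killed_comp ht hp b.1))

lemma measurable_laceP (hZcont : ContinuousOn Z (orthant Λ)) (m : ℕ) :
    Measurable fun q : (Fin (2 * m - 1) → ℝ) × PathSpace d => laceP Λ Z m q.1 q.2 := by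
  have hT : ∀ k, Measurable fun q : (Fin (2 * m - 1) → ℝ) × PathSpace d =>
      laceS' m q.1 k := by
    intro k
    unfold laceS'
    split_ifs
    · simp only [laceS_eq_timeAt]
      exact (measurable_timeAt _ _).comp measurable_fst
    · exact (measurable_timeAt (2 * m - 1) (2 * k)).comp measurable_fst
  have hY : ∀ i j, Measurable fun q : (Fin (2 * m - 1) → ℝ) × PathSpace d =>
      Yfun Λ Z q.2 (laceS' m q.1 i) (laceS' m q.1 j) := fun i j =>
    (measurable_comp_localTime hZcont (hT i) (hT j) measurable_snd).div_const _
  exact (hY _ _).mul (Finset.measurable_fun_prod _ fun i _ => (hY _ _).div (hY _ _))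

/-- A lace and a path in general position: the path starts at `x` and does not jump at the times
of the lace, and the bound on the vertex functions holds. -/
structure IsGeneric (Λ : Finset (Zd d)) (Z : (Λ → ℝ) → ℝ) (rbar : Λ → Λ → ℝ) (x : Λ) (m : ℕ)
    (r : Fin (2 * m - 1) → ℝ) (ω : PathSpace d) : Prop where
  mem : r ∈ orderedTimes (2 * m - 1)
  start : ω.1 0 = x.1
  noJump : ∀ k, (r k, ω) ∈ noJump d
  bound : ∀ u v : ℝ, 0 ≤ u → u < v → ∀ x y : Λ, |vertexAt Λ Z ω u v x y| ≤ rbar x y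

lemma IsGeneric.vertex_eq {rbar : Λ → Λ → ℝ} {x : Λ} {m : ℕ} {r : Fin (2 * m - 1) → ℝ}
    {ω : PathSpace d} (h : IsGeneric Λ Z rbar x m r ω) (hZpos : ∀ t ∈ orthant Λ, 0 < Z t)
    (hZ2 : ContDiffOn ℝ 2 Z (orthant Λ)) {j k : ℕ} (hjk : j < k) (hk : k ≤ 2 * m - 1) {a b : Λ}
    (ha : killed Λ ω (timeAt (2 * m - 1) r j) = some a.1)
    (hb : killed Λ ω (timeAt (2 * m - 1) r k) = some b.1) :
    vertex Λ Z ω (timeAt (2 * m - 1) r j) (timeAt (2 * m - 1) r k) =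
      vertexAt Λ Z ω (timeAt (2 * m - 1) r j) (timeAt (2 * m - 1) r k) a b := by
  have hn : ∀ i, 1 ≤ i → i ≤ 2 * m - 1 → (timeAt (2 * m - 1) r i, ω) ∈ LaceBound.noJump d := by
    intro i h1 h2
    obtain ⟨i, rfl⟩ := Nat.exists_eq_add_of_le' h1
    rw [timeAt_succ r h2]
    exact h.noJump _
  refine vertex_eq_vertexAt hZpos hZ2 (timeAt_nonneg h.mem (hjk.le.trans hk))
    (timeAt_lt_timeAt h.mem hjk hk) ?_ (eventually_killed_of_noJump (hn k (by omega) hk) hb)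
  rcases j.eq_zero_or_pos with rfl | hj
  · rw [timeAt_zero] at ha ⊢
    exact eventually_killed_zero ha
  · exact nhdsWithin_le_nhds (eventually_killed_of_noJump (hn j hj (by omega)) ha)

lemma IsGeneric.laceVertex_eq {rbar : Λ → Λ → ℝ} {x y : Λ} {m : ℕ} {r : Fin (2 * m - 1) → ℝ}
    {ω : PathSpace d} (h : IsGeneric Λ Z rbar x m r ω) (hZpos : ∀ t ∈ orthant Λ, 0 < Z t)
    (hZ2 : ContDiffOn ℝ 2 Z (orthant Λ))
    (hy : killed Λ ω (timeAt (2 * m - 1) r (2 * m - 1)) = some y.1) :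
    laceVertex Λ Z m r ω = ∏ i ∈ Finset.range m, vertexSum Λ Z ω
      (timeAt (2 * m - 1) r (2 * i - 1))
      (timeAt (2 * m - 1) r (min (2 * (i + 1)) (2 * m - 1))) := by
  refine Finset.prod_congr rfl fun i hi => ?_
  have hi := Finset.mem_range.1 hi
  rw [laceS_eq_timeAt, laceS'_eq_timeAt r hi]
  obtain ⟨a, ha⟩ := exists_killed_eq_some_of_le hy
    (timeAt_le_timeAt h.mem (show 2 * i - 1 ≤ 2 * m - 1 by omega) le_rfl)
  obtain ⟨b, hb⟩ := exists_killed_eq_some_of_le hy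
    (timeAt_le_timeAt h.mem (min_le_right (2 * (i + 1)) (2 * m - 1)) le_rfl)
  rw [vertexSum_eq ha hb, h.vertex_eq hZpos hZ2 (by omega) (by omega) ha hb]

/-- In general position, the integrand is bounded by the term of the diagram whose labels are the
positions of the walk at the times of the lace. -/
lemma IsGeneric.enorm_laceIntegrand_le {rbar : Λ → Λ → ℝ} {x : Λ} {m : ℕ} (hm : 1 ≤ m)
    {r : Fin (2 * m - 1) → ℝ} {ω : PathSpace d} (h : IsGeneric Λ Z rbar x m r ω)
    (hZpos : ∀ t ∈ orthant Λ, 0 < Z t) (hZ2 : ContDiffOn ℝ 2 Z (orthant Λ)) (y : Λ) :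
    ‖laceIntegrand Λ Z m y r ω‖ₑ ≤ ∑ v ∈ diagramVertices Λ m x y,
      ENNReal.ofReal (∏ i ∈ Finset.range m,
          rbar (v (Fin.ofNat (m + 1) i)).1 (v (Fin.ofNat (m + 1) (i + 1))).2) *
        walkWeight Λ Z laceBase (lacePoints v) (timeAt (2 * m - 1) r) (2 * m - 1) ω := by
  let N := 2 * m - 1
  have hN : N = 2 * m - 1 := rfl
  let T := timeAt N r
  have hlast : laceS' m r m = T N := by
    rw [laceS'_eq_timeAt r le_rfl, min_eq_right (by omega)]
  by_cases hy : killed Λ ω (T N) = some y.1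
  swap
  · have : laceIntegrand Λ Z m y r ω = 0 := by
      refine indicator_of_notMem (fun h => hy ?_) _
      rw [← hlast]; exact h
    simp [this]
  have hval : laceIntegrand Λ Z m y r ω = laceVertex Λ Z m r ω * laceP Λ Z m r ω :=
    indicator_of_mem (s := {ω' | killed Λ ω' (laceS' m r m) = some y.1}) (hlast ▸ hy) _
  have hpos : ∀ k, ∃ a : Λ, k ≤ N → killed Λ ω (T k) = some a.1 := by
    intro k
    by_cases hk : k ≤ N
    · obtain ⟨a, ha⟩ := exists_killed_eq_some_of_le hy (timeAt_le_timeAt h.mem hk le_rfl)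
      exact ⟨a, fun _ => ha⟩
    · exact ⟨x, fun h => absurd h hk⟩
  choose pos hpos using hpos
  have hposN : pos N = y :=
    Subtype.ext (Option.some_inj.1 ((hpos N le_rfl).symm.trans hy))
  have hpos0 : pos 0 = x := by
    have h0 := hpos 0 (by omega)
    rw [show T 0 = 0 from timeAt_zero N r, killed_eq_some_iff, Real.toNNReal_zero, h.start] at h0
    exact Subtype.ext h0.2.symm
  let v : Fin (m + 1) → Λ × Λ := fun i => (pos (2 * i - 1), pos (min (2 * i) N))
  have hvi : ∀ i ≤ m, v (Fin.ofNat (m + 1) i) = (pos (2 * i - 1), pos (min (2 * i) N)) := by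
    intro i hi
    have : ((Fin.ofNat (m + 1) i : Fin (m + 1)) : ℕ) = i := Nat.mod_eq_of_lt (by omega)
    simp only [v, this]
  have hv : v ∈ diagramVertices Λ m x y := by
    refine Finset.mem_filter.2 ⟨Finset.mem_univ _, ?_, ?_⟩
    · simp [v, hpos0]
    · simp only [v, Fin.val_last]
      rw [min_eq_right (by omega), ← hN, hposN]
  have hz : ∀ k ≤ N, lacePoints v k = pos k := by
    intro k hk
    obtain ⟨i, rfl | rfl⟩ := Nat.even_or_odd' k
    · rw [lacePoints_two_mul, hvi i (by omega), min_eq_left hk]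
    · rw [lacePoints_two_mul_add_one, hvi (i + 1) (by omega)]
      congr 1
  have hrat : ∀ I, 0 < Z (localTime Λ ω I) := fun I => hZpos _ (localTime_mem_orthant Λ ω I)
  -- all indicator functions in the weight of the walk are equal to one
  have hweight : walkWeight Λ Z laceBase (lacePoints v) T N ω =
      ENNReal.ofReal (laceP Λ Z m r ω) := by
    rw [laceP_eq_prod hZpos hm, ENNReal.ofReal_prod_of_nonneg fun k _ =>
      (div_pos (hrat _) (hrat _)).le, walkWeight]
    have h0 : killed Λ ω (T 0) = some (lacePoints v 0).1 := by
      rw [hz 0 (by omega)]; exact hpos 0 (by omega)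
    rw [indicator_of_mem (s := {ω' | killed Λ ω' (T 0) = some (lacePoints v 0).1}) h0,
      Pi.one_apply, one_mul]
    refine Finset.prod_congr rfl fun k hk => ?_
    have hk := Finset.mem_range.1 hk
    have h1 : killed Λ ω (T (k + 1)) = some (lacePoints v (k + 1)).1 := by
      rw [hz (k + 1) hk]; exact hpos (k + 1) hk
    exact indicator_of_mem (s := {ω' | killed Λ ω' (T (k + 1)) = some (lacePoints v (k + 1)).1})
      h1 _
  have hP0 : 0 ≤ laceP Λ Z m r ω := by
    rw [laceP_eq_prod hZpos hm]
    exact Finset.prod_nonneg fun k _ => (div_pos (hrat _) (hrat _)).le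
  have hvert : |laceVertex Λ Z m r ω| ≤ ∏ i ∈ Finset.range m,
      rbar (v (Fin.ofNat (m + 1) i)).1 (v (Fin.ofNat (m + 1) (i + 1))).2 := by
    rw [laceVertex, Finset.abs_prod]
    refine Finset.prod_le_prod (fun _ _ => abs_nonneg _) fun i hi => ?_
    have hi := Finset.mem_range.1 hi
    rw [hvi i hi.le, hvi (i + 1) hi, laceS_eq_timeAt, laceS'_eq_timeAt r hi,
      h.vertex_eq hZpos hZ2 (by omega) (by omega) (hpos _ (by omega)) (hpos _ (by omega))]
    exact h.bound _ _ (timeAt_nonneg h.mem (by omega))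
      (timeAt_lt_timeAt h.mem (by omega) (by omega)) _ _
  refine le_trans ?_ (Finset.single_le_sum (fun _ _ => zero_le) hv)
  change _ ≤ _ * walkWeight Λ Z laceBase (lacePoints v) T N ω
  rw [hweight, hval, ← ENNReal.ofReal_mul' hP0, Real.enorm_eq_ofReal_abs, abs_mul,
    abs_of_nonneg hP0]
  gcongr

/-- Almost every pair of a lace and a path is in general position. -/
lemma ae_isGeneric {J : Zd d → ℝ} {P : Zd d → Measure (PathSpace d)} (hP : IsWalkLaw J P)
    {rbar : Λ → Λ → ℝ} {x : Λ}
    (hR0 : ∀ᵐ ω ∂(P x), ∀ u v : ℝ, 0 ≤ u → u < v → ∀ x y : Λ,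
      |vertexAt Λ Z ω u v x y| ≤ rbar x y) (m : ℕ) :
    ∀ᵐ q ∂((volume.restrict (orderedTimes (2 * m - 1))).prod (P x)),
      IsGeneric Λ Z rbar x m q.1 q.2 := by
  have := hP.prob
  have hstart : ∀ᵐ ω ∂(P x), ω.1 0 = x.1 := by
    have h : ∀ z : Zd d, ∀ᵐ ω ∂(P x), z ≠ x.1 → ω.1 0 ≠ z := by
      intro z
      by_cases hz : z = x.1
      · simp [hz]
      · refine measure_mono_null ?_ (hP.start x.1 z {0} (by simp) (fun _ => z) rfl hz)
        intro ω hω s hs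
        simp only [mem_compl_iff, mem_ofPred_eq, ne_eq, not_forall, not_not] at hω
        rw [Finset.mem_singleton.1 hs]
        exact hω.2
    filter_upwards [ae_all_iff.2 h] with ω hω
    by_contra hc
    exact hω _ hc rfl
  have hjump : ∀ k, ∀ᵐ q ∂((volume.restrict (orderedTimes (2 * m - 1))).prod (P x)),
      (q.1 k, q.2) ∈ noJump d := by
    intro k
    have hf : Measurable fun q : (Fin (2 * m - 1) → ℝ) × PathSpace d => (q.1 k, q.2) := by fun_prop
    have hS : MeasurableSet {q : (Fin (2 * m - 1) → ℝ) × PathSpace d | (q.1 k, q.2) ∉ noJump d} :=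
      hf measurableSet_noJump.compl
    change _ = 0
    rw [show {q : (Fin (2 * m - 1) → ℝ) × PathSpace d | (q.1 k, q.2) ∈ noJump d}ᶜ =
      {q | (q.1 k, q.2) ∉ noJump d} from rfl, Measure.prod_apply_symm hS, lintegral_eq_zero_iff'
      (measurable_measure_prodMk_right hS).aemeasurable]
    refine .of_forall fun ω => ?_
    refine Measure.absolutelyContinuous_of_le Measure.restrict_le_self ?_
    exact (Measure.quasiMeasurePreserving_eval (fun _ => (volume : Measure ℝ)) k).preimage_null
      (ae_noJump ω)
  have h1 := (Measure.quasiMeasurePreserving_fst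
    (μ := volume.restrict (orderedTimes (2 * m - 1))) (ν := P x)).ae
      (ae_restrict_mem (measurableSet_orderedTimes _))
  have h2 := (Measure.quasiMeasurePreserving_snd
    (μ := volume.restrict (orderedTimes (2 * m - 1))) (ν := P x)).ae (hstart.and hR0)
  filter_upwards [h1, h2, ae_all_iff.2 hjump] with q hq1 hq2 hq3
  exact ⟨hq1, hq2.1, hq3, hq2.2⟩

end Bound

/-! ### Integrability and the bound on the lace expansion term -/

variable {Λ : Finset (Zd d)} {Z : (Λ → ℝ) → ℝ}

lemma aestronglyMeasurable_laceIntegrand {J : Zd d → ℝ} {P : Zd d → Measure (PathSpace d)}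
    (hP : IsWalkLaw J P) (hZpos : ∀ t ∈ orthant Λ, 0 < Z t) (hZ2 : ContDiffOn ℝ 2 Z (orthant Λ))
    {rbar : Λ → Λ → ℝ} {x : Λ}
    (hR0 : ∀ᵐ ω ∂(P x), ∀ u v : ℝ, 0 ≤ u → u < v → ∀ x y : Λ,
      |vertexAt Λ Z ω u v x y| ≤ rbar x y) {m : ℕ} (hm : 1 ≤ m) (y : Λ) :
    AEStronglyMeasurable
      (fun q : (Fin (2 * m - 1) → ℝ) × PathSpace d => laceIntegrand Λ Z m y q.1 q.2)
      ((volume.restrict (orderedTimes (2 * m - 1))).prod (P x)) := by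
  have hT : ∀ k, Measurable fun q : (Fin (2 * m - 1) → ℝ) × PathSpace d =>
      timeAt (2 * m - 1) q.1 k := fun k => (measurable_timeAt _ k).comp measurable_fst
  let S : Set ((Fin (2 * m - 1) → ℝ) × PathSpace d) :=
    {q | killed Λ q.2 (timeAt (2 * m - 1) q.1 (2 * m - 1)) = some y.1}
  have hS : MeasurableSet S := measurableSet_killed_comp (hT _) measurable_snd y.1
  let w : (Fin (2 * m - 1) → ℝ) × PathSpace d → ℝ := fun q =>
    (∏ i ∈ Finset.range m, vertexSum Λ Z q.2 (timeAt (2 * m - 1) q.1 (2 * i - 1))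
      (timeAt (2 * m - 1) q.1 (min (2 * (i + 1)) (2 * m - 1)))) * laceP Λ Z m q.1 q.2
  have hw : Measurable w :=
    (Finset.measurable_fun_prod _ fun i _ => measurable_vertexSum hZpos hZ2 (hT _) (hT _)
      measurable_snd).mul (measurable_laceP hZ2.continuousOn m)
  refine ⟨S.indicator w, (hw.indicator hS).stronglyMeasurable, ?_⟩
  filter_upwards [ae_isGeneric hP hR0 m] with q hq
  have hlast : laceS' m q.1 m = timeAt (2 * m - 1) q.1 (2 * m - 1) := by
    rw [laceS'_eq_timeAt _ le_rfl, min_eq_right (by omega)]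
  by_cases hy : killed Λ q.2 (timeAt (2 * m - 1) q.1 (2 * m - 1)) = some y.1
  · have h1 : laceIntegrand Λ Z m y q.1 q.2 = laceVertex Λ Z m q.1 q.2 * laceP Λ Z m q.1 q.2 :=
      indicator_of_mem (s := {ω' | killed Λ ω' (laceS' m q.1 m) = some y.1}) (hlast ▸ hy) _
    rw [h1, hq.laceVertex_eq hZpos hZ2 hy, indicator_of_mem (s := S) hy]
  · have h1 : laceIntegrand Λ Z m y q.1 q.2 = 0 := by
      refine indicator_of_notMem (fun h => hy ?_) _
      rw [← hlast]; exact h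
    rw [h1, indicator_of_notMem (s := S) hy]

/-- The bound on the integral of the weight of a walk, if `Z` is continuous on the orthant. -/
lemma lintegral_prod_walkWeight_le {J : Zd d → ℝ} (hJ : IsJumpFunction J)
    {P : Zd d → Measure (PathSpace d)} (hP : IsWalkLaw J P) (hZcont : ContinuousOn Z (orthant Λ))
    (hG : ∀ t ∈ orthant Λ, ∀ a b : Λ, greenE Λ Z P t a b ≤ greenE Λ Z P 0 a b)
    {β : ℕ → ℕ} (hβ : ∀ k, β k ≤ k) (z : ℕ → Λ) (x : Zd d) (n : ℕ) :
    ∫⁻ q, walkWeight Λ Z β z (timeAt n q.1) n q.2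
        ∂((volume.restrict (orderedTimes n)).prod (P x)) ≤
      ∏ k ∈ Finset.range n, greenE Λ Z P 0 (z k) (z (k + 1)) := by
  have := hP.prob
  have hZm : Measurable fun t => Z (toOrthant Λ t) := (continuous_comp_toOrthant hZcont).measurable
  have h0 : (0 : Λ → ℝ) ∈ orthant Λ := fun _ => le_rfl
  have h := lintegral_walkWeight_le hJ hP hZm (fun t ht a b => by
    rw [greenE_comp_toOrthant Z P ht, greenE_comp_toOrthant Z P h0]
    exact hG t ht a b) hβ z x n
  have hm := measurable_walkWeight hZm β z
    (t := fun q : (Fin n → ℝ) × PathSpace d => timeAt n q.1)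
    (fun k => (measurable_timeAt n k).comp measurable_fst)
    (measurable_snd (α := Fin n → ℝ) (β := PathSpace d)) n
  simp only [greenE_comp_toOrthant Z P h0] at h
  rw [← lintegral_prod (fun q : (Fin n → ℝ) × PathSpace d =>
    walkWeight Λ (fun t => Z (toOrthant Λ t)) β z (timeAt n q.1) n q.2) hm.aemeasurable] at h
  simpa only [walkWeight_comp_toOrthant] using h

lemma measurable_walkWeight_of_continuousOn (hZcont : ContinuousOn Z (orthant Λ)) (β : ℕ → ℕ)
    (z : ℕ → Λ) (n : ℕ) :
    Measurable fun q : (Fin n → ℝ) × PathSpace d => walkWeight Λ Z β z (timeAt n q.1) n q.2 := by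
  have h := measurable_walkWeight (continuous_comp_toOrthant hZcont).measurable β z
    (t := fun q : (Fin n → ℝ) × PathSpace d => timeAt n q.1)
    (fun k => (measurable_timeAt n k).comp measurable_fst)
    (measurable_snd (α := Fin n → ℝ) (β := PathSpace d)) n
  simpa only [walkWeight_comp_toOrthant] using h

end LaceBound

theorem proposition7p3
    {d : ℕ} (J : Zd d → ℝ) (hJ : IsJumpFunction J)
    (P : Zd d → Measure (PathSpace d)) (hP : IsWalkLaw J P)
    (Λ : Finset (Zd d)) (Z : (Λ → ℝ) → ℝ)
    -- Z1: strict positivity and continuity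
    (hZpos : ∀ t ∈ orthant Λ, 0 < Z t)
    (hZcont : ContinuousOn Z (orthant Λ))
    -- Z2: twice continuously differentiable up to the boundary
    (hZ2 : ContDiffOn ℝ 2 Z (orthant Λ))
    -- G0: finiteness of the Green's function
    (hG0 : ∀ a b : Λ, greenE Λ Z P 0 a b < ∞)
    -- G1
    (hG1 : ∀ t ∈ orthant Λ, ∀ a b : Λ, greenE Λ Z P t a b ≤ greenE Λ Z P 0 a b)
    -- R0
    (rbar : Λ → Λ → ℝ)
    (hR0 : ∀ a : Λ, ∀ᵐ ω ∂(P a), ∀ u v : ℝ, 0 ≤ u → u < v → ∀ x y : Λ,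
      |vertexAt Λ Z ω u v x y| ≤ rbar x y)
    (m : ℕ) (hm : 1 ≤ m) (x y : Λ) :
    Integrable (fun q : (Fin (2 * m - 1) → ℝ) × PathSpace d => laceIntegrand Λ Z m y q.1 q.2)
        ((volume.restrict (laces₀ m)).prod (P x)) ∧
      |lacePi Λ Z P m x y| ≤
        ∑ v ∈ diagramVertices Λ m x y,
          green₀ Λ Z P x (v (Fin.ofNat (m + 1) 1)).1 *
            rbar x (v (Fin.ofNat (m + 1) 1)).2 *
            ∏ j ∈ Finset.Ico 1 m,
              (green₀ Λ Z P (v (Fin.ofNat (m + 1) j)).1 (v (Fin.ofNat (m + 1) j)).2 *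
                green₀ Λ Z P (v (Fin.ofNat (m + 1) j)).2 (v (Fin.ofNat (m + 1) (j + 1))).1 *
                rbar (v (Fin.ofNat (m + 1) j)).1 (v (Fin.ofNat (m + 1) (j + 1))).2) := by
  
  have := hP.prob
  set μ := (volume.restrict (laces₀ m)).prod (P x)
  set B : ℝ := ∑ v ∈ diagramVertices Λ m x y,
    green₀ Λ Z P x (v (Fin.ofNat (m + 1) 1)).1 * rbar x (v (Fin.ofNat (m + 1) 1)).2 *
      ∏ j ∈ Finset.Ico 1 m,
        (green₀ Λ Z P (v (Fin.ofNat (m + 1) j)).1 (v (Fin.ofNat (m + 1) j)).2 *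
          green₀ Λ Z P (v (Fin.ofNat (m + 1) j)).2 (v (Fin.ofNat (m + 1) (j + 1))).1 *
          rbar (v (Fin.ofNat (m + 1) j)).1 (v (Fin.ofNat (m + 1) (j + 1))).2)
  -- `rbar` bounds absolute values on an event of probability one, so it is nonnegative
  have hrbar : ∀ a b, 0 ≤ rbar a b := by
    obtain ⟨ω, hω⟩ := (hR0 x).exists
    exact fun a b => (abs_nonneg _).trans (hω 0 1 le_rfl one_pos a b)
  have hgreen : ∀ a b : Λ, 0 ≤ green₀ Λ Z P a b := fun a b => ENNReal.toReal_nonneg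
  let c : (Fin (m + 1) → Λ × Λ) → ℝ := fun v => ∏ i ∈ Finset.range m,
    rbar (v (Fin.ofNat (m + 1) i)).1 (v (Fin.ofNat (m + 1) (i + 1))).2
  let e : (Fin (m + 1) → Λ × Λ) → ℝ := fun v => ∏ k ∈ Finset.range (2 * m - 1),
    green₀ Λ Z P (lacePoints v k) (lacePoints v (k + 1))
  have hc : ∀ v, 0 ≤ c v := fun v => Finset.prod_nonneg fun i _ => hrbar _ _
  have he : ∀ v, 0 ≤ e v := fun v => Finset.prod_nonneg fun i _ => hgreen _ _
  have hB : B = ∑ v ∈ diagramVertices Λ m x y, c v * e v :=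
    Finset.sum_congr rfl fun v hv => (diagram_eq_prod hm hv (green₀ Λ Z P) rbar).symm
  have hB0 : 0 ≤ B := hB ▸ Finset.sum_nonneg fun v _ => mul_nonneg (hc v) (he v)
  have hbound : ∫⁻ q, ‖laceIntegrand Λ Z m y q.1 q.2‖ₑ ∂μ ≤ ENNReal.ofReal B := by
    calc ∫⁻ q, ‖laceIntegrand Λ Z m y q.1 q.2‖ₑ ∂μ
        ≤ ∫⁻ q, ∑ v ∈ diagramVertices Λ m x y, ENNReal.ofReal (c v) *
            walkWeight Λ Z laceBase (lacePoints v) (timeAt (2 * m - 1) q.1) (2 * m - 1) q.2 ∂μ := by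
          refine lintegral_mono_ae ?_
          filter_upwards [ae_isGeneric hP (hR0 x) m] with q hq
          exact hq.enorm_laceIntegrand_le hm hZpos hZ2 y
      _ = ∑ v ∈ diagramVertices Λ m x y, ENNReal.ofReal (c v) * ∫⁻ q,
            walkWeight Λ Z laceBase (lacePoints v) (timeAt (2 * m - 1) q.1) (2 * m - 1) q.2 ∂μ := by
          rw [lintegral_finsetSum _ fun v _ =>
            (measurable_walkWeight_of_continuousOn hZcont _ _ _).const_mul _]
          exact Finset.sum_congr rfl fun v _ =>
            lintegral_const_mul _ (measurable_walkWeight_of_continuousOn hZcont _ _ _)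
      _ ≤ ∑ v ∈ diagramVertices Λ m x y, ENNReal.ofReal (c v) * ENNReal.ofReal (e v) := by
          refine Finset.sum_le_sum fun v _ => ?_
          gcongr
          refine (lintegral_prod_walkWeight_le hJ hP hZcont hG1 laceBase_le (lacePoints v)
            x (2 * m - 1)).trans_eq ?_
          rw [ENNReal.ofReal_prod_of_nonneg fun _ _ => hgreen _ _]
          exact Finset.prod_congr rfl fun k _ => (ENNReal.ofReal_toReal (hG0 _ _).ne).symm
      _ = ENNReal.ofReal B := by
          rw [hB, ENNReal.ofReal_sum_of_nonneg fun v _ => mul_nonneg (hc v) (he v)]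
          exact Finset.sum_congr rfl fun v _ => (ENNReal.ofReal_mul (hc v)).symm
  have hint : Integrable (fun q : (Fin (2 * m - 1) → ℝ) × PathSpace d =>
      laceIntegrand Λ Z m y q.1 q.2) μ :=
    ⟨aestronglyMeasurable_laceIntegrand hP hZpos hZ2 (hR0 x) hm y,
      hbound.trans_lt ENNReal.ofReal_lt_top⟩
  refine ⟨hint, ?_⟩
  have hpi : lacePi Λ Z P m x y = ∫ q, laceIntegrand Λ Z m y q.1 q.2 ∂μ :=
    (integral_prod _ hint).symm
  rw [hpi, ← Real.norm_eq_abs]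
  exact (norm_integral_le_lintegral_norm _).trans (ENNReal.toReal_le_of_le_ofReal hB0
    (by simpa only [ofReal_norm] using hbound))
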